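/- Let $N\ge 2$, $1\le M\le N$, $A\in\mathbb R^{N\times N}$, and let $B\in\mathbb R^{N\times M}$ have columns $b_1,\dots,b_M$. Consider the linear control system $\dot y=Ay+Bu$ with measurable controls $u$ satisfying $u(t)\in[-1,1]^M$ for a.e. $t\ge 0$. Assume that it is normal, i.e. $\mathrm{rank}\,[b_i,Ab_i,\dots,A^{N-1}b_i]=N$ for every $i=1,\dots,M$, and that $k:=\mathrm{rank}\,B<N$. For $r\ge 0$ let $\mathcal R_r$ be the set of points $x\in\mathbb R^N$ that can be steered to the origin within time $r$ (i.e. for some control $u$ the solution with $y(0)=x$ satisfies $y(t)=0$ for some $t\in[0,r]$), and let $\mathcal R=\bigcup_{r\ge 0}\mathcal R_r$ be the set of points which can be steered to the origin in finite time. Let $$\mathcal S=\Big\{x\in\mathbb R^N:\ \exists\, r>0,\ \exists\,\zeta\in\mathbb S^{N-1}\ \text{with}\ x=\sum_{i=1}^M\int_0^r e^{A(t-r)}b_i\,\mathrm{sign}\big(\langle\zeta,e^{At}b_i\rangle\big)\,dt\ \text{ and }\ \langle\zeta,b_i\rangle=0\ \ \forall i=1,\dots,M\Big\}.$$ Then $\mathcal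 S$ is contained in $\mathcal R\setminus\{0\}$ and is relatively closed in it: there is a closed set $C\subseteq\mathbb R^N$ with $\mathcal S=C\cap(\mathcal R\setminus\{0\})$. Moreover, $\mathcal S$ is countably $(N-k)$-rectifiable, i.e. $\mathcal H^{N-k}$-measurable and contained in a countable union of images of Lipschitz maps $\mathbb R^{N-k}\to\mathbb R^N$. More precisely, for every $r>0$ there exist countably many Lipschitz functions $f_j:\mathbb R^{N-k-1}\to\mathbb R^N$ such that $\mathcal S\cap\mathrm{bdry}\,\mathcal R_r\subseteq\bigcup_j f_j(\mathbb R^{N-k-1})$. -/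

import Mathlib

open MeasureTheory

noncomputable section

/-- Action of a real matrix on Euclidean vectors. -/
def matAct {m n : ℕ} (C : Matrix (Fin m) (Fin n) ℝ) (v : EuclideanSpace ℝ (Fin n)) :
    EuclideanSpace ℝ (Fin m) :=
  WithLp.toLp 2 (C.mulVec v.ofLp)

/-- The `i`-th column `b_i` of `B`, as a Euclidean vector. -/
def colVec {m n : ℕ} (B : Matrix (Fin m) (Fin n) ℝ) (i : Fin n) : EuclideanSpace ℝ (Fin m) :=
  WithLp.toLp 2 (fun a => B a i)

/-- The vector `e^{tA} b_i`. -/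
def expCol {N M : ℕ} (A : Matrix (Fin N) (Fin N) ℝ) (B : Matrix (Fin N) (Fin M) ℝ)
    (i : Fin M) (t : ℝ) : EuclideanSpace ℝ (Fin N) :=
  matAct (NormedSpace.exp (t • A)) (colVec B i)

/-- The system `ẏ = A y + B u` is normal: for every column `b_i` of `B`,
`rank [b_i, A b_i, …, A^{N-1} b_i] = N`. -/
def IsNormalSystem {N M : ℕ} (A : Matrix (Fin N) (Fin N) ℝ) (B : Matrix (Fin N) (Fin M) ℝ) :
    Prop :=
  ∀ i : Fin M,
    (Matrix.of (fun (a j : Fin N) => matAct (A ^ (j : ℕ)) (colVec B i) a)).rank = N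

/-- Admissible controls: measurable functions with values in `[-1,1]^M` almost everywhere.
(A control given on `[0,∞)` is extended by `0` to negative times, which play no role.) -/
def IsAdmissibleControl {M : ℕ} (u : ℝ → EuclideanSpace ℝ (Fin M)) : Prop :=
  Measurable u ∧ ∀ᵐ s, ∀ i, u s i ∈ Set.Icc (-1 : ℝ) 1

/-- `y` is the Carathéodory solution on `[0,∞)` of `ẏ = A y + B u` a.e., `y(0) = x`,
written as the equivalent integral equation. -/
def IsTrajectory {N M : ℕ} (A : Matrix (Fin N) (Fin N) ℝ) (B : Matrix (Fin N) (Fin M) ℝ)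
    (x : EuclideanSpace ℝ (Fin N)) (u : ℝ → EuclideanSpace ℝ (Fin M))
    (y : ℝ → EuclideanSpace ℝ (Fin N)) : Prop :=
  ContinuousOn y (Set.Ici 0) ∧
    ∀ t : ℝ, 0 ≤ t → y t = x + ∫ s in (0 : ℝ)..t, (matAct A (y s) + matAct B (u s))

/-- `R_r`: the points which can be steered to the origin within the time `r`, that is, the
sublevel `{T ≤ r}` of the minimum time function `T`. -/
def steerableWithin {N M : ℕ} (A : Matrix (Fin N) (Fin N) ℝ) (B : Matrix (Fin N) (Fin M) ℝ)
    (r : ℝ) : Set (EuclideanSpace ℝ (Fin N)) :=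
  {x | ∃ u y, IsAdmissibleControl u ∧ IsTrajectory A B x u y ∧ ∃ t ∈ Set.Icc 0 r, y t = 0}

/-- The points which can be steered to the origin in some finite time, that is, the domain
`{T < ∞}` of the minimum time function `T`. -/
def steerable {N M : ℕ} (A : Matrix (Fin N) (Fin N) ℝ) (B : Matrix (Fin N) (Fin M) ℝ) :
    Set (EuclideanSpace ℝ (Fin N)) :=
  ⋃ r : ℝ, steerableWithin A B r

/-- The set `S`: the points `x = ∑ i, ∫_0^r e^{A(t-r)} b_i sign ⟨ζ, e^{At} b_i⟩ dt` with `r > 0`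
and `ζ` in the unit sphere orthogonal to all columns of `B`. -/
def singularSet {N M : ℕ} (A : Matrix (Fin N) (Fin N) ℝ) (B : Matrix (Fin N) (Fin M) ℝ) :
    Set (EuclideanSpace ℝ (Fin N)) :=
  {x | ∃ r : ℝ, 0 < r ∧ ∃ ζ ∈ Metric.sphere (0 : EuclideanSpace ℝ (Fin N)) 1,
    x = ∑ i, ∫ t in (0 : ℝ)..r, Real.sign (inner ℝ ζ (expCol A B i t)) • expCol A B i (t - r) ∧
    ∀ i, inner ℝ ζ (colVec B i) = 0}

/-- `E` is covered by countably many Lipschitz images of `ℝ^d`. -/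
def CoveredByLipschitzImages {N : ℕ} (d : ℕ) (E : Set (EuclideanSpace ℝ (Fin N))) : Prop :=
  ∃ f : ℕ → EuclideanSpace ℝ (Fin d) → EuclideanSpace ℝ (Fin N),
    (∀ j, ∃ K, LipschitzWith K (f j)) ∧ E ⊆ ⋃ j, Set.range (f j)

/-- Countably `d`-rectifiable sets: `H^d`-measurable (in the sense of Carathéodory) and covered,
with no exceptional set, by countably many Lipschitz images of `ℝ^d`. -/
def IsCountablyRectifiable {N : ℕ} (d : ℕ) (E : Set (EuclideanSpace ℝ (Fin N))) : Prop :=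
  (Measure.hausdorffMeasure (d : ℝ) :
    Measure (EuclideanSpace ℝ (Fin N))).toOuterMeasure.IsCaratheodory E ∧
  CoveredByLipschitzImages d E

end

/-! By variation of constants, the points steered to the origin within time r are the values of `∑
i, ∫_0^r u_i(s) e^{-sA} b_i ds` over controls bounded by 1. The set S is the image of a map Φ(ζ, r),
where ζ is a unit covector in ker Bᵀ, a space of dimension N - k, and r > 0. Thus N - k parameters
are available.

The difficulty is that Φ need not be Lipschitz in ζ, since a switching function `⟨ζ, e^{tA} b_i⟩`
may have multiple zeros, which move too fast and split under perturbation. By normality, however,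
all zeros have finite order. The parameters are therefore sorted into countably many pieces
according to where the zeros lie, to within rational intervals, which order they have, and how large
the first nonvanishing derivative is. Inside a piece a zero of order m is also a simple zero of the
derivative of order m - 1, so it depends on ζ in a Lipschitz way, and the sign of the switching
function is decided by the side of that zero (`IsZeroDatum.exists_sign_eq`). Signs for two covectors
then differ on a set of measure O(|ζ - ζ'|), and Φ is Lipschitz on each piece
(`exists_lipschitzOnWith_signIntegral`). Φ depends only on the ray of ζ, so affine charts replace
the sphere.

Two facts on reachable sets give the rest. A support function that strictly increases in time keeps
Φ(ζ, r) out of the closure of the reachable set at every earlier time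
(`signIntegral_notMem_closure_reachSet`), and an invertible Gramian puts each reachable set in the
interior of every later one (`reachSet_subset_interior`). Hence a point of S on the boundary at time
r has time parameter exactly r, which removes one dimension. The same facts bound the time parameter
near a steerable point, and relative closedness follows from continuity of Φ and compactness. -/

/-! ### Lipschitz products and the sign function. -/

/-- A product of a bounded Lipschitz operator-valued map and a bounded Lipschitz map is Lipschitz. -/
theorem LipschitzOnWith.exists_clm_apply {α E F : Type*} [PseudoMetricSpace α]
    [NormedAddCommGroup E] [NormedSpace ℝ E] [NormedAddCommGroup F] [NormedSpace ℝ F]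
    {s : Set α} {f : α → E →L[ℝ] F} {g : α → E} {K L : NNReal} {C D : ℝ}
    (hf : LipschitzOnWith K f s) (hg : LipschitzOnWith L g s)
    (hfC : ∀ x ∈ s, ‖f x‖ ≤ C) (hgD : ∀ x ∈ s, ‖g x‖ ≤ D) :
    ∃ K', LipschitzOnWith K' (fun x => f x (g x)) s := by
  refine ⟨Real.toNNReal (|C| * L + K * |D|), LipschitzOnWith.of_dist_le_mul fun x hx y hy => ?_⟩
  rw [Real.coe_toNNReal _ (by positivity), dist_eq_norm]
  have h1 := hf.dist_le_mul x hx y hy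
  have h2 := hg.dist_le_mul x hx y hy
  rw [dist_eq_norm] at h1 h2
  have e : f x (g x) - f y (g y) = f x (g x - g y) + (f x - f y) (g y) := by
    simp
  rw [e]
  calc ‖f x (g x - g y) + (f x - f y) (g y)‖
      ≤ ‖f x‖ * ‖g x - g y‖ + ‖f x - f y‖ * ‖g y‖ :=
        (norm_add_le _ _).trans (add_le_add ((f x).le_opNorm _) ((f x - f y).le_opNorm _))
    _ ≤ |C| * (L * dist x y) + (K * dist x y) * |D| := by
        gcongr
        · exact (hfC x hx).trans (le_abs_self _)
        · exact (hgD y hy).trans (le_abs_self _)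
    _ = _ := by ring

theorem Real.sign_eq_sign_of_mul_pos {a x y : ℝ} (hx : 0 < a * x) (hy : 0 < a * y) :
    Real.sign x = Real.sign y := by
  rcases pos_and_pos_or_neg_and_neg_of_mul_pos hx with ⟨ha, h⟩ | ⟨ha, h⟩
  · rw [Real.sign_of_pos h, Real.sign_of_pos (pos_of_mul_pos_right hy ha.le)]
  · rw [Real.sign_of_neg h, Real.sign_of_neg (by nlinarith)]

theorem Real.sign_mul_of_pos {a : ℝ} (ha : 0 < a) (x : ℝ) :
    Real.sign (a * x) = Real.sign x := by
  rcases lt_trichotomy x 0 with h | rfl | h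
  · rw [Real.sign_of_neg h, Real.sign_of_neg (mul_neg_of_pos_of_neg ha h)]
  · simp
  · rw [Real.sign_of_pos h, Real.sign_of_pos (mul_pos ha h)]

theorem Real.measurable_sign : Measurable Real.sign := by
  unfold Real.sign
  exact Measurable.ite measurableSet_Iio measurable_const
    (Measurable.ite measurableSet_Ioi measurable_const measurable_const)

theorem Real.abs_sign_le_one (x : ℝ) : |Real.sign x| ≤ 1 := by
  rcases Real.sign_apply_eq x with h | h | h <;> simp [h]

theorem Real.continuousAt_sign {x : ℝ} (hx : x ≠ 0) : ContinuousAt Real.sign x := by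
  rcases lt_or_gt_of_ne hx with h | h
  · refine (continuousAt_const (y := (-1 : ℝ))).congr ?_
    filter_upwards [Iio_mem_nhds h] with y hy using (Real.sign_of_neg hy).symm
  · refine (continuousAt_const (y := (1 : ℝ))).congr ?_
    filter_upwards [Ioi_mem_nhds h] with y hy using (Real.sign_of_pos hy).symm

/-! ### Zeros of finite order. -/

/-- If the `m`-th derivative is positive on an interval and all lower derivatives vanish at `τ`,
then the sign of the function on the interval is that of `(t - τ) ^ m`. -/
theorem sign_of_iterated_deriv_pos {p q τ : ℝ} (hτ : τ ∈ Set.Icc p q) (m : ℕ) :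
    ∀ (f : ℕ → ℝ → ℝ), (∀ j t, HasDerivAt (f j) (f (j + 1) t) t) →
      (∀ t ∈ Set.Icc p q, 0 < f m t) → (∀ j < m, f j τ = 0) →
      ∀ t ∈ Set.Icc p q, (τ < t → 0 < f 0 t) ∧ (t < τ → 0 < (-1) ^ m * f 0 t) := by
  induction m with
  | zero =>
    intro f _ hpos _ t ht
    simpa using ⟨fun _ => hpos t ht, fun _ => hpos t ht⟩
  | succ m ih =>
    intro f hf hpos h0 t ht
    have ih' := ih (fun j => f (j + 1)) (fun j t => hf (j + 1) t) hpos
      (fun j hj => h0 (j + 1) (by omega))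
    have hτ0 := h0 0 (by omega)
    constructor
    · intro hlt
      -- As `f 0 τ = 0`, the mean value theorem gives `f 0 t` the sign of `(t - τ) * f 1 c`, with
      -- `c` on the same side of `τ` as `t`.
      obtain ⟨c, hc, hc'⟩ := exists_hasDerivAt_eq_slope (f 0) (f 1) hlt
        (fun x _ => (hf 0 x).continuousAt.continuousWithinAt) (fun x _ => hf 0 x)
      have h1 : 0 < f 1 c := (ih' c ⟨hτ.1.trans hc.1.le, hc.2.le.trans ht.2⟩).1 hc.1
      rw [hc', hτ0, sub_zero] at h1
      exact (div_pos_iff_of_pos_right (sub_pos.2 hlt)).1 h1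
    · intro hlt
      obtain ⟨c, hc, hc'⟩ := exists_hasDerivAt_eq_slope (f 0) (f 1) hlt
        (fun x _ => (hf 0 x).continuousAt.continuousWithinAt) (fun x _ => hf 0 x)
      have h1 : 0 < (-1) ^ m * f 1 c := (ih' c ⟨ht.1.trans hc.1.le, hc.2.le.trans hτ.2⟩).2 hc.2
      rw [hc', hτ0, zero_sub, ← mul_div_assoc] at h1
      have := (div_pos_iff_of_pos_right (sub_pos.2 hlt)).1 h1
      rw [pow_succ]
      linarith

/-- Local data for the zeros of a function: an interval with rational end points, the order of the
zero, and an integer bounding the derivative of that order away from zero. -/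
abbrev ZeroDatum := ℚ × ℚ × ℕ × ℤ

/-- The function `f 0` with derivatives `f j` has a zero of order `m` in the interval, and its
derivative of order `m` is bounded away from zero there. -/
def IsZeroDatum (f : ℕ → ℝ → ℝ) (D : ZeroDatum) : Prop :=
  (∀ t ∈ Set.Icc (D.1 : ℝ) D.2.1, 1 ≤ (D.2.2.2 : ℝ) * f D.2.2.1 t) ∧
    ∃ τ ∈ Set.Icc (D.1 : ℝ) D.2.1, ∀ j < D.2.2.1, f j τ = 0

theorem IsZeroDatum.sign {f : ℕ → ℝ → ℝ} (hf : ∀ j t, HasDerivAt (f j) (f (j + 1) t) t)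
    {p q τ : ℝ} (hτ : τ ∈ Set.Icc p q) {m : ℕ} {c : ℝ}
    (h1 : ∀ t ∈ Set.Icc p q, 1 ≤ c * f m t) (h0 : ∀ j < m, f j τ = 0) :
    ∀ t ∈ Set.Icc p q, (τ < t → 0 < c * f 0 t) ∧ (t < τ → 0 < ((-1) ^ m * c) * f 0 t) := by
  intro t ht
  have := sign_of_iterated_deriv_pos hτ m (fun j t => c * f j t)
    (fun j t => (hf j t).const_mul c) (fun t ht => one_pos.trans_le (h1 t ht))
    (fun j hj => by simp [h0 j hj]) t ht
  simpa [mul_assoc] using this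

/-- The first derivative that does not vanish at `t` gives the order, with `t` itself as the zero;
continuity keeps that derivative large on a rational interval around `t`. Rational end points and an
integer bound make the data countable. -/
theorem exists_isZeroDatum {f : ℕ → ℝ → ℝ} (hf : ∀ j t, HasDerivAt (f j) (f (j + 1) t) t)
    {t : ℝ} (ht : ∃ j, f j t ≠ 0) :
    ∃ D : ZeroDatum, t ∈ Set.Ioo (D.1 : ℝ) D.2.1 ∧ IsZeroDatum f D := by
  classical
  obtain ⟨m, hm, hlt⟩ : ∃ m, f m t ≠ 0 ∧ ∀ j < m, f j t = 0 :=
    ⟨Nat.find ht, Nat.find_spec ht, fun j hj => not_not.1 (Nat.find_min ht hj)⟩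
  obtain ⟨n, hn⟩ := exists_nat_gt (|f m t|⁻¹)
  have hn' : 1 < n * |f m t| := by
    rwa [inv_lt_iff_one_lt_mul₀ (abs_pos.2 hm)] at hn
  -- `c` carries the sign of the derivative; the strict inequality leaves room for `1 ≤ c * f m`
  -- nearby.
  obtain ⟨c, hc⟩ : ∃ c : ℤ, 1 < (c : ℝ) * f m t := by
    rcases abs_cases (f m t) with ⟨h, _⟩ | ⟨h, _⟩
    · exact ⟨n, by rw [h] at hn'; simpa using hn'⟩
    · exact ⟨-n, by rw [h] at hn'; push_cast; linarith⟩
  have hcont : ContinuousAt (fun s => (c : ℝ) * f m s) t := continuousAt_const.mul (hf m t).continuousAt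
  obtain ⟨l, u, hlu, hsub⟩ := mem_nhds_iff_exists_Ioo_subset.1 (hcont.eventually (Ioi_mem_nhds hc))
  obtain ⟨p, hp, hp'⟩ := exists_rat_btwn hlu.1
  obtain ⟨q, hq, hq'⟩ := exists_rat_btwn hlu.2
  refine ⟨(p, q, m, c), ⟨hp', hq⟩, fun s hs => ?_, t, ⟨hp'.le, hq.le⟩, hlt⟩
  exact (hsub ⟨hp.trans_le hs.1, hs.2.trans_lt hq'⟩ : (1 : ℝ) < c * f m s).le

theorem exists_finset_isZeroDatum {f : ℕ → ℝ → ℝ} (hf : ∀ j t, HasDerivAt (f j) (f (j + 1) t) t)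
    (hne : ∀ t, ∃ j, f j t ≠ 0) (R : ℝ) :
    ∃ S : Finset ZeroDatum, (∀ D ∈ S, IsZeroDatum f D) ∧
      ∀ t ∈ Set.Icc 0 R, ∃ D ∈ S, t ∈ Set.Icc (D.1 : ℝ) D.2.1 := by
  obtain ⟨b', hb', hfin, hcov⟩ := (isCompact_Icc (a := (0 : ℝ)) (b := R)).elim_finite_subcover_image
    (b := {D : ZeroDatum | IsZeroDatum f D}) (c := fun D => Set.Ioo (D.1 : ℝ) D.2.1)
    (fun _ _ => isOpen_Ioo) (fun t _ => by
      obtain ⟨D, h1, h2⟩ := exists_isZeroDatum hf (hne t)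
      exact Set.mem_biUnion h2 h1)
  refine ⟨hfin.toFinset, fun D hD => hb' (hfin.mem_toFinset.1 hD), fun t ht => ?_⟩
  obtain ⟨D, hD, h⟩ := Set.mem_iUnion₂.1 (hcov ht)
  exact ⟨D, hfin.mem_toFinset.2 hD, Set.Ioo_subset_Icc_self h⟩

/-- There are countably many data, and the sign rule allows at most one zero in the interval of
each. -/
theorem countable_zeros {f : ℕ → ℝ → ℝ} (hf : ∀ j t, HasDerivAt (f j) (f (j + 1) t) t)
    (hne : ∀ t, ∃ j, f j t ≠ 0) : {t | f 0 t = 0}.Countable := by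
  have hsub : {t | f 0 t = 0} ⊆ ⋃ D : ZeroDatum,
      {t | IsZeroDatum f D ∧ t ∈ Set.Icc (D.1 : ℝ) D.2.1 ∧ f 0 t = 0} := by
    intro t ht
    obtain ⟨D, h1, h2⟩ := exists_isZeroDatum hf (hne t)
    exact Set.mem_iUnion.2 ⟨D, h2, Set.Ioo_subset_Icc_self h1, ht⟩
  refine (Set.countable_iUnion fun D => Set.Subsingleton.countable ?_).mono hsub
  have key : ∀ t, IsZeroDatum f D → t ∈ Set.Icc (D.1 : ℝ) D.2.1 → f 0 t = 0 →
      ∀ τ ∈ Set.Icc (D.1 : ℝ) D.2.1, (∀ j < D.2.2.1, f j τ = 0) → t = τ := by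
    intro t hD ht h0 τ hτ hj
    have := IsZeroDatum.sign hf hτ hD.1 hj t ht
    rw [h0] at this
    rcases lt_trichotomy t τ with h | h | h
    · simpa using this.2 h
    · exact h
    · simpa using this.1 h
  rintro t ⟨hD, ht, h0⟩ s ⟨_, hs, hs0⟩
  obtain ⟨τ, hτ, hj⟩ := hD.2
  rw [key t hD ht h0 τ hτ hj, key s hD hs hs0 τ hτ hj]

/-! ### Dependence of the signs on the covector. -/

section inner

variable {E : Type*} [NormedAddCommGroup E] [InnerProductSpace ℝ E]

theorem hasDerivAt_inner_left {v : ℕ → ℝ → E} (hv : ∀ j t, HasDerivAt (v j) (v (j + 1) t) t)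
    (ζ : E) (j : ℕ) (t : ℝ) :
    HasDerivAt (fun t => inner ℝ ζ (v j t)) (inner ℝ ζ (v (j + 1) t)) t :=
  (innerSL ℝ ζ).hasFDerivAt.comp_hasDerivAt t (hv j t)

/-- On the interval of a common zero datum, the set where the signs of two of the functions
`t ↦ ⟪ζ, v 0 t⟫` differ has measure controlled by the distance of the parameters. -/
theorem IsZeroDatum.exists_sign_eq {v : ℕ → ℝ → E}
    (hv : ∀ j t, HasDerivAt (v j) (v (j + 1) t) t) (D : ZeroDatum) :
    ∃ C : ℝ, 0 ≤ C ∧ ∀ ζ ζ' : E, IsZeroDatum (fun j t => inner ℝ ζ (v j t)) D →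
      IsZeroDatum (fun j t => inner ℝ ζ' (v j t)) D →
      ∃ U : Set ℝ, volume U ≤ ENNReal.ofReal (C * ‖ζ - ζ'‖) ∧
        ∀ t ∈ Set.Icc (D.1 : ℝ) D.2.1, t ∉ U →
          Real.sign (inner ℝ ζ (v 0 t)) = Real.sign (inner ℝ ζ' (v 0 t)) := by
  obtain ⟨p, q, m, c⟩ := D
  cases m with
  | zero =>
    refine ⟨0, le_rfl, fun ζ ζ' h h' => ⟨∅, by simp, fun t ht _ => ?_⟩⟩
    exact Real.sign_eq_sign_of_mul_pos (one_pos.trans_le (h.1 t ht)) (one_pos.trans_le (h'.1 t ht))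
  | succ m =>
    have hcont : Continuous (v m) := continuous_iff_continuousAt.2 fun t => (hv m t).continuousAt
    obtain ⟨B, hB⟩ := (isCompact_Icc (a := (p : ℝ)) (b := q)).exists_bound_of_continuousOn
      hcont.continuousOn
    refine ⟨|(c : ℝ)| * |B|, by positivity, fun ζ ζ' h h' => ?_⟩
    obtain ⟨h1, τ, hτ, h0⟩ := h
    obtain ⟨h1', τ', hτ', h0'⟩ := h'
    have hd := hasDerivAt_inner_left hv
    refine ⟨Set.uIcc τ τ', ?_, fun t ht htU => ?_⟩
    · rw [Real.volume_interval]
      refine ENNReal.ofReal_le_ofReal ?_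
      -- The order is now `m + 1`, so `c` times the derivative of order `m` has slope at least 1:
      -- the distance of a point from its zero `τ` is bounded by its value there.
      have hm1 : ∀ a ∈ Set.Icc (p : ℝ) q, ∀ b ∈ Set.Icc (p : ℝ) q, a ≤ b →
          1 * (b - a) ≤ (c : ℝ) * inner ℝ ζ (v m b) - c * inner ℝ ζ (v m a) := by
        refine (convex_Icc (p : ℝ) q).mul_sub_le_image_sub_of_le_deriv
          (f := fun t => (c : ℝ) * inner ℝ ζ (v m t)) ?_ ?_ ?_
        · exact fun t _ => ((hd ζ m t).const_mul _).continuousAt.continuousWithinAt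
        · exact fun t _ => ((hd ζ m t).const_mul _).differentiableAt.differentiableWithinAt
        · intro t ht
          rw [((hd ζ m t).const_mul _).deriv]
          exact h1 t (interior_subset ht)
      have hz : inner ℝ ζ (v m τ) = 0 := h0 m (Nat.lt_succ_self m)
      have hz' : inner ℝ ζ' (v m τ') = 0 := h0' m (Nat.lt_succ_self m)
      have hle : |τ' - τ| ≤ |(c : ℝ) * inner ℝ ζ (v m τ')| := by
        rcases le_total τ τ' with hh | hh
        · have := hm1 τ hτ τ' hτ' hh
          rw [hz] at this
          rw [abs_of_nonneg (sub_nonneg.2 hh)]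
          exact le_trans (by linarith) (le_abs_self _)
        · have := hm1 τ' hτ' τ hτ hh
          rw [hz] at this
          rw [abs_of_nonpos (sub_nonpos.2 hh)]
          exact le_trans (by linarith) (neg_le_abs _)
      -- At `τ'` the derivative for `ζ'` vanishes, so the value for `ζ` is linear in `ζ - ζ'`.
      have e : inner ℝ ζ (v m τ') = inner ℝ (ζ - ζ') (v m τ') := by rw [inner_sub_left, hz', sub_zero]
      rw [e, abs_mul] at hle
      refine hle.trans ?_
      rw [mul_assoc]
      refine mul_le_mul_of_nonneg_left ?_ (abs_nonneg _)
      rw [mul_comm]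
      exact (abs_real_inner_le_norm _ _).trans
        (mul_le_mul_of_nonneg_left ((hB τ' hτ').trans (le_abs_self _)) (norm_nonneg _))
    -- Outside the interval between `τ` and `τ'`, the point `t` lies on the same side of both zeros.
    · have s := IsZeroDatum.sign (hd ζ) hτ h1 h0 t ht
      have s' := IsZeroDatum.sign (hd ζ') hτ' h1' h0' t ht
      rw [Set.uIcc, Set.mem_Icc, not_and_or, not_le, not_le, lt_inf_iff, sup_lt_iff] at htU
      rcases htU with ⟨a, a'⟩ | ⟨a, a'⟩
      · exact Real.sign_eq_sign_of_mul_pos (s.2 a) (s'.2 a')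
      · exact Real.sign_eq_sign_of_mul_pos (s.1 a) (s'.1 a')

theorem IsZeroDatum.exists_sign_eq_finset {v : ℕ → ℝ → E}
    (hv : ∀ j t, HasDerivAt (v j) (v (j + 1) t) t) (S : Finset ZeroDatum) :
    ∃ C : ℝ, 0 ≤ C ∧ ∀ ζ ζ' : E, (∀ D ∈ S, IsZeroDatum (fun j t => inner ℝ ζ (v j t)) D) →
      (∀ D ∈ S, IsZeroDatum (fun j t => inner ℝ ζ' (v j t)) D) →
      ∃ U : Set ℝ, volume U ≤ ENNReal.ofReal (C * ‖ζ - ζ'‖) ∧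
        ∀ D ∈ S, ∀ t ∈ Set.Icc (D.1 : ℝ) D.2.1, t ∉ U →
          Real.sign (inner ℝ ζ (v 0 t)) = Real.sign (inner ℝ ζ' (v 0 t)) := by
  choose C hC hU using fun D => IsZeroDatum.exists_sign_eq hv D
  refine ⟨∑ D ∈ S, C D, Finset.sum_nonneg fun D _ => hC D, fun ζ ζ' h h' => ?_⟩
  choose! U hU2 hU3 using fun D (hD : D ∈ S) => hU D ζ ζ' (h D hD) (h' D hD)
  refine ⟨⋃ D ∈ S, U D, ?_, fun D hD t ht htU => ?_⟩
  · refine (measure_biUnion_finset_le S U).trans ?_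
    rw [Finset.sum_mul, ENNReal.ofReal_sum_of_nonneg fun D _ => mul_nonneg (hC D) (norm_nonneg _)]
    exact Finset.sum_le_sum hU2
  · exact hU3 D hD t ht fun h => htU (Set.mem_biUnion hD h)

end inner

/-! ### Bang-bang integrals: continuity and Lipschitz estimates. -/

section bangbang

variable {E : Type*} [NormedAddCommGroup E] [InnerProductSpace ℝ E]
variable {ι : Type*}

/-- The integral `∑ i, ∫_0^r sign ⟪ζ, w i t⟫ w i t dt`. -/
noncomputable def signIntegral [Fintype ι] (w : ι → ℝ → E) (ζ : E) (r : ℝ) : E :=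
  ∑ i, ∫ t in (0 : ℝ)..r, Real.sign (inner ℝ ζ (w i t)) • w i t

theorem norm_sign_smul_le (w : ℝ → E) (ζ : E) (t : ℝ) :
    ‖Real.sign (inner ℝ ζ (w t)) • w t‖ ≤ ‖w t‖ := by
  rw [norm_smul, Real.norm_eq_abs]
  exact mul_le_of_le_one_left (norm_nonneg _) (Real.abs_sign_le_one _)

theorem aestronglyMeasurable_sign_smul {w : ℝ → E} (hw : Continuous w) (ζ : E) (μ : Measure ℝ) :
    AEStronglyMeasurable (fun t => Real.sign (inner ℝ ζ (w t)) • w t) μ :=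
  ((Real.measurable_sign.comp (continuous_const.inner hw).measurable).aestronglyMeasurable).smul
    hw.aestronglyMeasurable

theorem intervalIntegrable_sign_smul {w : ℝ → E} (hw : Continuous w) (ζ : E) (a b : ℝ) :
    IntervalIntegrable (fun t => Real.sign (inner ℝ ζ (w t)) • w t) volume a b :=
  (hw.norm.intervalIntegrable a b).mono_fun (aestronglyMeasurable_sign_smul hw ζ _)
    (Filter.Eventually.of_forall fun t => by
      simpa using norm_sign_smul_le w ζ t)

/-- Dominated convergence: for `t` outside a countable set the integrand is continuous in the
covector at `ζ`. -/
theorem continuousAt_signIntegral [Fintype ι] {w : ι → ℝ → E} (hw : ∀ i, Continuous (w i)) {ζ : E}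
    (hζ : ∀ i, {t | inner ℝ ζ (w i t) = 0}.Countable) (r : ℝ) :
    ContinuousAt (fun p : E × ℝ => signIntegral w p.1 p.2) (ζ, r) := by
  unfold signIntegral
  refine tendsto_finsetSum _ fun i _ => ?_
  have := intervalIntegral.continuousAt_parametric_primitive_of_dominated (μ := volume)
    (F := fun (ζ : E) t => Real.sign (inner ℝ ζ (w i t)) • w i t) (x₀ := ζ)
    (fun t => ‖w i t‖) (-|r| - 1) (|r| + 1) (a₀ := 0) (b₀ := r)
    (fun ζ => aestronglyMeasurable_sign_smul (hw i) ζ _)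
    (Filter.Eventually.of_forall fun ζ => Filter.Eventually.of_forall fun t =>
      norm_sign_smul_le (w i) ζ t)
    ((hw i).norm.intervalIntegrable _ _) ?_ ?_ ?_ (by simp)
  · exact this
  · refine ae_restrict_of_ae ?_
    filter_upwards [(hζ i).ae_notMem volume] with t ht
    refine ContinuousAt.smul ?_ continuousAt_const
    exact (Real.continuousAt_sign ht).comp (f := fun ζ : E => inner ℝ ζ (w i t))
      (continuous_id.inner continuous_const).continuousAt
  · constructor <;> linarith [abs_nonneg r]
  · constructor <;> linarith [abs_nonneg r, neg_abs_le r, le_abs_self r]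

/-- The parameters `(ζ, r)` with `0 ≤ r ≤ R` such that the functions `t ↦ ⟪ζ, v i 0 t⟫` have the
zero data `S i`, the intervals of which cover `[0, R]`. -/
def zeroPiece (v : ι → ℕ → ℝ → E) (R : ℕ) (S : ι → Finset ZeroDatum) : Set (E × ℝ) :=
  {p | p.2 ∈ Set.Icc (0 : ℝ) R ∧ ∀ i, (∀ D ∈ S i, IsZeroDatum (fun j t => inner ℝ p.1 (v i j t)) D) ∧
    ∀ t ∈ Set.Icc (0 : ℝ) R, ∃ D ∈ S i, t ∈ Set.Icc (D.1 : ℝ) D.2.1}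

theorem exists_mem_zeroPiece {v : ι → ℕ → ℝ → E}
    (hv : ∀ i j t, HasDerivAt (v i j) (v i (j + 1) t) t) {ζ : E}
    (hζ : ∀ i t, ∃ j, inner ℝ ζ (v i j t) ≠ 0) {r : ℝ} (hr : 0 ≤ r) :
    ∃ R S, (ζ, r) ∈ zeroPiece v R S := by
  obtain ⟨R, hR⟩ := exists_nat_ge r
  choose S hS using fun i => exists_finset_isZeroDatum (hasDerivAt_inner_left (hv i) ζ) (hζ i) R
  exact ⟨R, S, ⟨hr, hR⟩, hS⟩

theorem norm_integral_sign_sub_le {w : ℝ → E} (hw : Continuous w) {ζ ζ' : E} {r R B c : ℝ}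
    (hr : r ∈ Set.Icc 0 R) (hB : ∀ t ∈ Set.Icc 0 R, ‖w t‖ ≤ B) {U : Set ℝ}
    (hUc : volume U ≤ ENNReal.ofReal c) (hc : 0 ≤ c)
    (hsign : ∀ t ∈ Set.Icc 0 R, t ∉ U →
      Real.sign (inner ℝ ζ (w t)) = Real.sign (inner ℝ ζ' (w t))) :
    ‖(∫ t in (0 : ℝ)..r, Real.sign (inner ℝ ζ (w t)) • w t) -
      ∫ t in (0 : ℝ)..r, Real.sign (inner ℝ ζ' (w t)) • w t‖ ≤ 2 * B * c := by
  have hB0 : 0 ≤ B := (norm_nonneg _).trans (hB 0 ⟨le_rfl, hr.1.trans hr.2⟩)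
  rw [← intervalIntegral.integral_sub (intervalIntegrable_sign_smul hw _ _ _)
    (intervalIntegrable_sign_smul hw _ _ _), intervalIntegral.integral_of_le hr.1]
  have hIcc : ∀ t ∈ Set.Ioc 0 r, t ∈ Set.Icc 0 R := fun t ht => ⟨ht.1.le, ht.2.trans hr.2⟩
  rw [setIntegral_eq_of_subset_of_forall_sdiff_eq_zero (s := Set.Ioc 0 r ∩ U)
    measurableSet_Ioc Set.inter_subset_left (fun t ht => ?_)]
  · have hfin : volume (Set.Ioc 0 r ∩ U) < ⊤ :=
      (measure_mono Set.inter_subset_right).trans_lt (hUc.trans_lt ENNReal.ofReal_lt_top)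
    refine (norm_setIntegral_le_of_norm_le_const (C := 2 * B) hfin fun t ht => ?_).trans ?_
    · have := hB t (hIcc t ht.1)
      refine (norm_sub_le _ _).trans ?_
      linarith [norm_sign_smul_le w ζ t, norm_sign_smul_le w ζ' t]
    · refine mul_le_mul_of_nonneg_left ?_ (by positivity)
      exact ENNReal.toReal_le_of_le_ofReal hc ((measure_mono Set.inter_subset_right).trans hUc)
  · have hnU : t ∉ U := fun h => ht.2 ⟨ht.1, h⟩
    rw [hsign t (hIcc t ht.1) hnU, sub_self]

theorem norm_signIntegral_le {w : ι → ℝ → E} {R B : ℝ}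
    (hB : ∀ i, ∀ t ∈ Set.Icc 0 R, ‖w i t‖ ≤ B) (ζ : E) {r s : ℝ} (hr : r ∈ Set.Icc 0 R)
    (hs : s ∈ Set.Icc 0 R) (i : ι) :
    ‖∫ t in r..s, Real.sign (inner ℝ ζ (w i t)) • w i t‖ ≤ B * |s - r| := by
  refine intervalIntegral.norm_integral_le_of_norm_le_const fun t ht => ?_
  have ht' : t ∈ Set.Icc 0 R := Set.ordConnected_Icc.uIcc_subset hr hs (Set.uIoc_subset_uIcc ht)
  exact (norm_sign_smul_le (w i) ζ t).trans (hB i t ht')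

theorem exists_lipschitzOnWith_signIntegral [Fintype ι] {v : ι → ℕ → ℝ → E}
    (hv : ∀ i j t, HasDerivAt (v i j) (v i (j + 1) t) t) (R : ℕ) (S : ι → Finset ZeroDatum) :
    (∃ K, LipschitzOnWith K (fun p : E × ℝ => signIntegral (fun i => v i 0) p.1 p.2)
      (zeroPiece v R S)) ∧
    ∃ C, ∀ p ∈ zeroPiece v R S, ‖signIntegral (fun i => v i 0) p.1 p.2‖ ≤ C := by
  have hcont : ∀ i, Continuous (v i 0) := fun i =>
    continuous_iff_continuousAt.2 fun t => (hv i 0 t).continuousAt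
  choose B hB using fun i => (isCompact_Icc (a := (0 : ℝ)) (b := R)).exists_bound_of_continuousOn
    (hcont i).continuousOn
  have hB' : ∀ i, ∀ t ∈ Set.Icc (0 : ℝ) R, ‖v i 0 t‖ ≤ ∑ i, |B i| := fun i t ht =>
    ((hB i t ht).trans (le_abs_self _)).trans
      (Finset.single_le_sum (f := fun i => |B i|) (fun _ _ => abs_nonneg _) (Finset.mem_univ i))
  set b := ∑ i, |B i| with hb
  have hb0 : 0 ≤ b := Finset.sum_nonneg fun _ _ => abs_nonneg _
  constructor
  · choose C hC0 hC using fun i => IsZeroDatum.exists_sign_eq_finset (hv i) (S i)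
    refine ⟨Real.toNNReal (∑ i, (2 * b * C i + b)), LipschitzOnWith.of_dist_le_mul ?_⟩
    rintro ⟨ζ, r⟩ ⟨hr, hp⟩ ⟨ζ', r'⟩ ⟨hr', hp'⟩
    rw [Real.coe_toNNReal _ (Finset.sum_nonneg fun i _ =>
      add_nonneg (mul_nonneg (by positivity) (hC0 i)) hb0), dist_eq_norm]
    simp only [signIntegral]
    rw [← Finset.sum_sub_distrib, Finset.sum_mul]
    refine norm_sum_le_of_le _ fun i _ => ?_
    obtain ⟨U, hU2, hU3⟩ := hC i ζ ζ' (hp i).1 (hp' i).1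
    have h1 := norm_integral_sign_sub_le (hcont i) hr (hB' i) hU2
      (mul_nonneg (hC0 i) (norm_nonneg _)) (fun t ht htU => by
        obtain ⟨D, hD, hDt⟩ := (hp i).2 t ht
        exact hU3 D hD t hDt htU)
    have h2 := norm_signIntegral_le hB' ζ' hr' hr i
    rw [← intervalIntegral.integral_interval_sub_left
      (intervalIntegrable_sign_smul (hcont i) ζ' 0 r)
      (intervalIntegrable_sign_smul (hcont i) ζ' 0 r')] at h2
    have h3 : ‖ζ - ζ'‖ ≤ dist (ζ, r) (ζ', r') := by
      rw [← dist_eq_norm]; exact le_max_left _ _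
    have h4 : |r - r'| ≤ dist (ζ, r) (ζ', r') := le_max_right (dist ζ ζ') (dist r r')
    -- The intermediate point is `(ζ', r)`: the covector changes at fixed time, then the time.
    calc _ ≤ _ := norm_sub_le_norm_sub_add_norm_sub _ _ _
      _ ≤ 2 * b * (C i * ‖ζ - ζ'‖) + b * |r - r'| := add_le_add h1 h2
      _ ≤ 2 * b * (C i * dist (ζ, r) (ζ', r')) + b * dist (ζ, r) (ζ', r') := by
        gcongr
        exact hC0 i
      _ = _ := by ring
  · refine ⟨∑ _i : ι, b * R, fun p hp => norm_sum_le_of_le _ fun i _ => ?_⟩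
    refine (norm_signIntegral_le hB' p.1 ⟨le_rfl, hp.1.1.trans hp.1.2⟩ hp.1 i).trans ?_
    rw [sub_zero, abs_of_nonneg hp.1.1]
    exact mul_le_mul_of_nonneg_left hp.1.2 hb0

end bangbang

/-! ### Reachable sets: support function and interior. -/

section reach

variable {E : Type*} [NormedAddCommGroup E] [InnerProductSpace ℝ E]
variable {ι : Type*} [Fintype ι]

/-- The points `∑ i, ∫_0^r u i s • w i s ds` for measurable controls `u` with values in `[-1,1]`. -/
def reachSet (w : ι → ℝ → E) (r : ℝ) : Set E :=
  {x | ∃ u : ι → ℝ → ℝ, (∀ i, Measurable (u i)) ∧ (∀ i, ∀ᵐ s, |u i s| ≤ 1) ∧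
    x = ∑ i, ∫ s in (0 : ℝ)..r, u i s • w i s}

omit [Fintype ι] in
theorem intervalIntegrable_control_smul {w : ℝ → E} (hw : Continuous w) {u : ℝ → ℝ}
    (hu : Measurable u) (hu1 : ∀ᵐ s, |u s| ≤ 1) (a b : ℝ) :
    IntervalIntegrable (fun s => u s • w s) volume a b :=
  (hw.norm.intervalIntegrable a b).mono_fun
    (hu.aestronglyMeasurable.smul hw.aestronglyMeasurable) (by
      refine ae_restrict_of_ae ?_
      filter_upwards [hu1] with s hs
      rw [norm_smul, norm_norm, Real.norm_eq_abs]
      exact mul_le_of_le_one_left (norm_nonneg _) hs)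

theorem intervalIntegral_piecewise {F : Type*} [NormedAddCommGroup F] [NormedSpace ℝ F]
    {f g : ℝ → F} {r s : ℝ} (hr : 0 ≤ r) (hrs : r ≤ s)
    (hf : ∀ a b, IntervalIntegrable f volume a b) (hg : ∀ a b, IntervalIntegrable g volume a b) :
    ∫ t in (0 : ℝ)..s, (if t ≤ r then f t else g t) =
      (∫ t in (0 : ℝ)..r, f t) + ∫ t in r..s, g t := by
  have e1 : Set.EqOn (fun t => if t ≤ r then f t else g t) f (Set.uIoc 0 r) := fun t ht => by
    rw [Set.uIoc_of_le hr] at ht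
    simp [ht.2]
  have e2 : Set.EqOn (fun t => if t ≤ r then f t else g t) g (Set.uIoc r s) := fun t ht => by
    rw [Set.uIoc_of_le hrs] at ht
    simp [ht.1]
  rw [← intervalIntegral.integral_add_adjacent_intervals (b := r)
    ((hf 0 r).congr e1.symm) ((hg r s).congr e2.symm),
    intervalIntegral.integral_congr_ae (Filter.Eventually.of_forall e1),
    intervalIntegral.integral_congr_ae (Filter.Eventually.of_forall e2)]

theorem reachSet_mono {w : ι → ℝ → E} (hw : ∀ i, Continuous (w i)) {r s : ℝ} (hr : 0 ≤ r)
    (hrs : r ≤ s) : reachSet w r ⊆ reachSet w s := by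
  rintro x ⟨u, hu, hu1, rfl⟩
  refine ⟨fun i t => if t ≤ r then u i t else 0,
    fun i => Measurable.ite measurableSet_Iic (hu i) measurable_const, fun i => ?_, ?_⟩
  · filter_upwards [hu1 i] with t ht
    split_ifs
    · exact ht
    · simp
  · refine Finset.sum_congr rfl fun i _ => ?_
    have := intervalIntegral_piecewise (f := fun t => u i t • w i t) (g := fun t => (0 : E)) hr hrs
      (intervalIntegrable_control_smul (hw i) (hu i) (hu1 i)) (fun a b => by simp)
    simp only [intervalIntegral.integral_zero, add_zero] at this
    rw [← this]
    simp only [ite_smul, zero_smul]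

theorem signIntegral_mem_reachSet {w : ι → ℝ → E} (hw : ∀ i, Continuous (w i)) (η : E) (r : ℝ) :
    signIntegral w η r ∈ reachSet w r :=
  ⟨fun i t => Real.sign (inner ℝ η (w i t)),
    fun i => Real.measurable_sign.comp (continuous_const.inner (hw i)).measurable,
    fun _ => Filter.Eventually.of_forall fun _ => Real.abs_sign_le_one _, rfl⟩

omit [Fintype ι] in
theorem inner_intervalIntegral [CompleteSpace E] {f : ℝ → E} {a b : ℝ}
    (hf : IntervalIntegrable f volume a b) (η : E) :
    inner ℝ η (∫ t in a..b, f t) = ∫ t in a..b, inner ℝ η (f t) :=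
  ((innerSL ℝ η).intervalIntegral_comp_comm hf).symm

theorem inner_le_of_mem_reachSet [CompleteSpace E] {w : ι → ℝ → E} (hw : ∀ i, Continuous (w i))
    {r : ℝ} (hr : 0 ≤ r) (η : E) {x : E} (hx : x ∈ reachSet w r) :
    inner ℝ η x ≤ ∑ i, ∫ t in (0 : ℝ)..r, |inner ℝ η (w i t)| := by
  obtain ⟨u, hu, hu1, rfl⟩ := hx
  rw [inner_sum]
  refine Finset.sum_le_sum fun i _ => ?_
  have hint := intervalIntegrable_control_smul (hw i) (hu i) (hu1 i) 0 r
  rw [inner_intervalIntegral hint]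
  refine intervalIntegral.integral_mono_ae hr ⟨hint.1.const_inner η, hint.2.const_inner η⟩
    ((continuous_const.inner (hw i)).abs.intervalIntegrable _ _) ?_
  filter_upwards [hu1 i] with t ht
  rw [inner_smul_right]
  refine (le_abs_self _).trans ?_
  rw [abs_mul]
  exact mul_le_of_le_one_left (abs_nonneg _) ht

/-- With `inner_le_of_mem_reachSet`, this identifies the support function of the reachable set for
`r ≥ 0` and shows that the bang-bang point attains it. -/
theorem inner_signIntegral [CompleteSpace E] {w : ι → ℝ → E} (hw : ∀ i, Continuous (w i))
    (η : E) (r : ℝ) :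
    inner ℝ η (signIntegral w η r) = ∑ i, ∫ t in (0 : ℝ)..r, |inner ℝ η (w i t)| := by
  rw [signIntegral, inner_sum]
  refine Finset.sum_congr rfl fun i _ => ?_
  rw [inner_intervalIntegral (intervalIntegrable_sign_smul (hw i) _ _ _)]
  refine intervalIntegral.integral_congr fun t _ => ?_
  simp only [inner_smul_right]
  rcases lt_trichotomy (inner ℝ η (w i t)) 0 with h | h | h
  · rw [Real.sign_of_neg h, abs_of_neg h]; ring
  · simp [h]
  · rw [Real.sign_of_pos h, abs_of_pos h]; ring

omit [Fintype ι] in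
theorem exists_mem_Icc_of_countable {S : Set ℝ} (hS : S.Countable) {a b : ℝ} (hab : a < b) :
    ∃ c ∈ Set.Icc a b, c ∉ S := by
  by_contra! h
  have : volume (Set.Icc a b) = 0 := measure_mono_null h (hS.measure_zero volume)
  rw [Real.volume_Icc, ENNReal.ofReal_eq_zero] at this
  linarith

theorem sum_integral_abs_inner_lt [Nonempty ι] {w : ι → ℝ → E} (hw : ∀ i, Continuous (w i)) {η : E}
    (hη : ∀ i, {t | inner ℝ η (w i t) = 0}.Countable) {s r : ℝ} (hsr : s < r) :
    ∑ i, ∫ t in (0 : ℝ)..s, |inner ℝ η (w i t)| < ∑ i, ∫ t in (0 : ℝ)..r, |inner ℝ η (w i t)| := by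
  refine Finset.sum_lt_sum_of_nonempty Finset.univ_nonempty fun i _ => ?_
  have hc : Continuous fun t => |inner ℝ η (w i t)| := (continuous_const.inner (hw i)).abs
  rw [← intervalIntegral.integral_add_adjacent_intervals (b := s)
    (hc.intervalIntegrable 0 s) (hc.intervalIntegrable s r)]
  refine lt_add_of_pos_right _ (intervalIntegral.integral_pos hsr hc.continuousOn
    (fun _ _ => abs_nonneg _) ?_)
  obtain ⟨c, hc, hc'⟩ := exists_mem_Icc_of_countable (hη i) hsr
  exact ⟨c, hc, abs_pos.2 hc'⟩

/-- A bang-bang point at time `r` lies outside the closure of the reachable set at times `s < r`. -/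
theorem signIntegral_notMem_closure_reachSet [CompleteSpace E] [Nonempty ι] {w : ι → ℝ → E}
    (hw : ∀ i, Continuous (w i)) {η : E} (hη : ∀ i, {t | inner ℝ η (w i t) = 0}.Countable)
    {s r : ℝ} (hs : 0 ≤ s) (hsr : s < r) : signIntegral w η r ∉ closure (reachSet w s) := by
  intro hmem
  -- A closed half-space contains the earlier reachable set but not the bang-bang point.
  have hcl : IsClosed {x : E | inner ℝ η x ≤ ∑ i, ∫ t in (0 : ℝ)..s, |inner ℝ η (w i t)|} :=
    isClosed_le (continuous_const.inner continuous_id) continuous_const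
  have h : inner ℝ η (signIntegral w η r) ≤ ∑ i, ∫ t in (0 : ℝ)..s, |inner ℝ η (w i t)| :=
    closure_minimal (fun x hx => inner_le_of_mem_reachSet hw hs η hx) hcl hmem
  rw [inner_signIntegral hw] at h
  exact absurd h (sum_integral_abs_inner_lt hw hη hsr).not_ge

theorem signIntegral_ne_zero [CompleteSpace E] [Nonempty ι] {w : ι → ℝ → E}
    (hw : ∀ i, Continuous (w i)) {η : E} (hη : ∀ i, {t | inner ℝ η (w i t) = 0}.Countable)
    {r : ℝ} (hr : 0 < r) : signIntegral w η r ≠ 0 := by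
  intro h
  have h1 := inner_signIntegral hw η r
  have h2 := sum_integral_abs_inner_lt hw hη hr
  rw [h, inner_zero_right] at h1
  simp [← h1] at h2

/-- The controllability Gramian of a curve. -/
noncomputable def gramian (w : ℝ → E) (hw : Continuous w) (s r : ℝ) : E →ₗ[ℝ] E where
  toFun η := ∫ t in s..r, inner ℝ η (w t) • w t
  map_add' η θ := by
    rw [← intervalIntegral.integral_add]
    · simp only [inner_add_left, add_smul]
    · exact ((continuous_const.inner hw).smul hw).intervalIntegrable _ _
    · exact ((continuous_const.inner hw).smul hw).intervalIntegrable _ _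
  map_smul' c η := by
    rw [RingHom.id_apply, ← intervalIntegral.integral_smul]
    simp only [real_inner_smul_left, mul_smul]

/-- The quadratic form of the Gramian is the integral of `⟪η, w t⟫ ^ 2`, which is positive because
the zeros are countable. -/
theorem gramian_injective [CompleteSpace E] {w : ℝ → E} (hw : Continuous w)
    (hw0 : ∀ η : E, η ≠ 0 → {t | inner ℝ η (w t) = 0}.Countable) {s r : ℝ} (hsr : s < r) :
    Function.Injective (gramian w hw s r) := by
  rw [← LinearMap.ker_eq_bot, LinearMap.ker_eq_bot']
  intro η h
  by_contra hη
  have hint : IntervalIntegrable (fun t => inner ℝ η (w t) • w t) volume s r :=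
    ((continuous_const.inner hw).smul hw).intervalIntegrable _ _
  have h1 : inner ℝ η (gramian w hw s r η) = ∫ t in s..r, inner ℝ η (w t) * inner ℝ η (w t) := by
    change inner ℝ η (∫ t in s..r, inner ℝ η (w t) • w t) = _
    rw [inner_intervalIntegral hint]
    simp only [inner_smul_right]
  have h2 : 0 < ∫ t in s..r, inner ℝ η (w t) * inner ℝ η (w t) := by
    refine intervalIntegral.integral_pos hsr
      ((continuous_const.inner hw).mul (continuous_const.inner hw)).continuousOn
      (fun _ _ => mul_self_nonneg _) ?_
    obtain ⟨c, hc, hc'⟩ := exists_mem_Icc_of_countable (hw0 η hη) hsr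
    exact ⟨c, hc, mul_self_pos.2 hc'⟩
  rw [← h1, h, inner_zero_right] at h2
  exact lt_irrefl _ h2

/-- The spare time from `s` to `r` is spent on one curve with control `⟪η, w t⟫`, η small. This adds
the Gramian applied to `η`, and such vectors fill a neighbourhood of 0. -/
theorem reachSet_subset_interior [FiniteDimensional ℝ E] [Nonempty ι] {w : ι → ℝ → E}
    (hw : ∀ i, Continuous (w i))
    (hw0 : ∀ η : E, η ≠ 0 → ∀ i, {t | inner ℝ η (w i t) = 0}.Countable) {s r : ℝ} (hs : 0 ≤ s)
    (hsr : s < r) : reachSet w s ⊆ interior (reachSet w r) := by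
  classical
  have : CompleteSpace E := FiniteDimensional.complete ℝ E
  rintro x ⟨u, hu, hu1, rfl⟩
  let i₀ : ι := Classical.arbitrary ι
  obtain ⟨B, hB⟩ := (isCompact_Icc (a := s) (b := r)).exists_bound_of_continuousOn
    (hw i₀).continuousOn
  let G := (LinearEquiv.ofInjectiveEndo _
    (gramian_injective (hw i₀) (fun η hη => hw0 η hη i₀) hsr)).toContinuousLinearEquiv
  have hopen : IsOpen (G '' Metric.ball 0 (|B| + 1)⁻¹) :=
    G.toHomeomorph.isOpenMap _ Metric.isOpen_ball
  set x := ∑ i, ∫ t in (0 : ℝ)..s, u i t • w i t with hx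
  refine mem_interior.2 ⟨(fun y => x + y) '' (G '' Metric.ball 0 (|B| + 1)⁻¹), ?_,
    (Homeomorph.addLeft x).isOpenMap _ hopen, 0, ⟨0, Metric.mem_ball_self (by positivity),
      map_zero G⟩, add_zero x⟩
  rintro _ ⟨_, ⟨η, hη, rfl⟩, rfl⟩
  rw [mem_ball_zero_iff] at hη
  -- The truncation only makes the control admissible at all times; it is inactive on `[s, r]`,
  -- because `‖η‖ < (|B| + 1)⁻¹`.
  let c : ι → ℝ → ℝ := fun i t => if i = i₀ then max (-1) (min 1 (inner ℝ η (w i₀ t))) else 0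
  have hcm : ∀ i, Measurable (c i) := fun i => by
    by_cases h : i = i₀
    · simp only [c, h, if_true]
      exact measurable_const.max (measurable_const.min
        (continuous_const.inner (hw i₀)).measurable)
    · simp only [c, h, if_false]
      exact measurable_const
  have hc1 : ∀ i t, |c i t| ≤ 1 := fun i t => by
    by_cases h : i = i₀
    · simp only [c, h, if_true, abs_le]
      exact ⟨le_max_left _ _, max_le (by norm_num) (min_le_left _ _)⟩
    · simp [c, h]
  refine ⟨fun i t => if t ≤ s then u i t else c i t,
    fun i => Measurable.ite measurableSet_Iic (hu i) (hcm i), fun i => ?_, ?_⟩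
  · filter_upwards [hu1 i] with t ht
    split_ifs
    · exact ht
    · exact hc1 i t
  · have key : ∀ i, ∫ t in (0 : ℝ)..r, (if t ≤ s then u i t else c i t) • w i t =
        (∫ t in (0 : ℝ)..s, u i t • w i t) + ∫ t in s..r, c i t • w i t := fun i => by
      rw [← intervalIntegral_piecewise hs hsr.le
        (intervalIntegrable_control_smul (hw i) (hu i) (hu1 i))
        (intervalIntegrable_control_smul (hw i) (hcm i)
          (Filter.Eventually.of_forall fun t => hc1 i t))]
      simp only [ite_smul]
    rw [Finset.sum_congr rfl fun i _ => key i, Finset.sum_add_distrib, hx]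
    congr 1
    rw [Finset.sum_eq_single i₀ (fun i _ hi => by simp [c, hi]) (by simp)]
    change ∫ t in s..r, inner ℝ η (w i₀ t) • w i₀ t = _
    refine intervalIntegral.integral_congr fun t ht => ?_
    rw [Set.uIcc_of_le hsr.le] at ht
    have hle : |inner ℝ η (w i₀ t)| ≤ 1 := by
      refine (abs_real_inner_le_norm _ _).trans ?_
      have h1 : ‖w i₀ t‖ ≤ |B| + 1 := (hB t ht).trans ((le_abs_self B).trans (by linarith))
      calc ‖η‖ * ‖w i₀ t‖ ≤ (|B| + 1)⁻¹ * (|B| + 1) := by gcongr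
        _ = 1 := inv_mul_cancel₀ (by positivity)
    rw [abs_le] at hle
    simp only [c, if_true, min_eq_right hle.2, max_eq_right hle.1]

end reach

/-! ### Integration by parts for bounded measurable integrands. -/

theorem exists_lipschitzOnWith_Icc {F : Type*} [NormedAddCommGroup F] [NormedSpace ℝ F]
    {L L' : ℝ → F} (hL : ∀ t, HasDerivAt L (L' t) t) (hL' : Continuous L') (a b : ℝ) :
    ∃ K, LipschitzOnWith K L (Set.Icc a b) := by
  have hd : deriv L = L' := funext fun t => (hL t).deriv
  have : ContDiff ℝ 1 L :=
    contDiff_one_iff_deriv.2 ⟨fun t => (hL t).differentiableAt, hd ▸ hL'⟩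
  exact this.contDiffOn.exists_lipschitzOnWith (by decide) (convex_Icc _ _) isCompact_Icc

theorem lipschitzOnWith_primitive {F : Type*} [NormedAddCommGroup F] [NormedSpace ℝ F]
    {h : ℝ → F} {T C : ℝ} (hint : IntervalIntegrable h volume 0 T)
    (hC : ∀ᵐ s, s ∈ Set.Icc 0 T → ‖h s‖ ≤ C) :
    LipschitzOnWith (Real.toNNReal C) (fun t => ∫ s in (0 : ℝ)..t, h s) (Set.Icc 0 T) := by
  refine LipschitzOnWith.of_dist_le_mul fun t ht s hs => ?_
  have hint' : ∀ t ∈ Set.Icc 0 T, IntervalIntegrable h volume 0 t := fun t ht =>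
    hint.mono_set (by
      rw [Set.uIcc_of_le ht.1, Set.uIcc_of_le (ht.1.trans ht.2)]
      exact Set.Icc_subset_Icc_right ht.2)
  rw [dist_eq_norm, intervalIntegral.integral_interval_sub_left (hint' t ht) (hint' s hs)]
  rw [Real.dist_eq]
  refine (intervalIntegral.norm_integral_le_of_norm_le_const_ae ?_).trans
    (mul_le_mul_of_nonneg_right (Real.le_coe_toNNReal C) (abs_nonneg _))
  filter_upwards [hC] with x hx hxI
  exact hx (Set.ordConnected_Icc.uIcc_subset hs ht (Set.uIoc_subset_uIcc hxI))

section ibp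

variable {E : Type*} [NormedAddCommGroup E] [NormedSpace ℝ E] [CompleteSpace E]

/-- Integration by parts for a `C¹` path of operators applied to the primitive of an essentially
bounded function. -/
theorem integral_clm_apply_primitive {L L' : ℝ → E →L[ℝ] E} (hL : ∀ t, HasDerivAt L (L' t) t)
    (hL' : Continuous L') {h : ℝ → E} {T C : ℝ} (x : E) (hT : 0 ≤ T)
    (hint : IntervalIntegrable h volume 0 T) (hC : ∀ᵐ s, s ∈ Set.Icc 0 T → ‖h s‖ ≤ C) :
    L 0 x + ∫ s in (0 : ℝ)..T, (L' s (x + ∫ σ in (0 : ℝ)..s, h σ) + L s (h s)) =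
      L T (x + ∫ s in (0 : ℝ)..T, h s) := by
  have hLc : Continuous L := continuous_iff_continuousAt.2 fun t => (hL t).continuousAt
  set w : ℝ → E := fun t => x + ∫ s in (0 : ℝ)..t, h s with hw
  set k : ℝ → E := fun s => L' s (w s) + L s (h s) with hk
  have hwL : LipschitzOnWith (Real.toNNReal C) w (Set.Icc 0 T) := by
    simpa using ((LipschitzWith.const x).lipschitzOnWith (s := Set.Icc 0 T)).add
      (lipschitzOnWith_primitive hint hC)
  obtain ⟨K, hLL⟩ := exists_lipschitzOnWith_Icc hL hL' 0 T
  obtain ⟨B, hB⟩ := (isCompact_Icc (a := (0 : ℝ)) (b := T)).exists_bound_of_continuousOn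
    hLc.continuousOn
  obtain ⟨B', hB'⟩ := (isCompact_Icc (a := (0 : ℝ)) (b := T)).exists_bound_of_continuousOn
    hL'.continuousOn
  obtain ⟨W, hW⟩ := (isCompact_Icc (a := (0 : ℝ)) (b := T)).exists_bound_of_continuousOn
    hwL.continuousOn
  have hIoc : Set.uIoc 0 T ⊆ Set.Icc 0 T := by
    rw [Set.uIoc_of_le hT]; exact Set.Ioc_subset_Icc_self
  have hkC : ∀ᵐ s, s ∈ Set.Icc 0 T → ‖k s‖ ≤ |B'| * |W| + |B| * |C| := by
    filter_upwards [hC] with s hs hsI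
    refine (norm_add_le _ _).trans (add_le_add ?_ ?_)
    · exact ((L' s).le_opNorm _).trans (mul_le_mul ((hB' s hsI).trans (le_abs_self _))
        ((hW s hsI).trans (le_abs_self _)) (norm_nonneg _) (abs_nonneg _))
    · exact ((L s).le_opNorm _).trans (mul_le_mul ((hB s hsI).trans (le_abs_self _))
        ((hs hsI).trans (le_abs_self _)) (norm_nonneg _) (abs_nonneg _))
  have hkint : IntervalIntegrable k volume 0 T := by
    have h1 : IntervalIntegrable (fun s => L' s (w s)) volume 0 T := by
      refine ContinuousOn.intervalIntegrable ?_
      rw [Set.uIcc_of_le hT]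
      exact hL'.continuousOn.clm_apply hwL.continuousOn
    refine h1.add ((intervalIntegrable_const (c := |B| * |C|)).mono_fun ?_ ?_)
    · exact isBoundedBilinearMap_apply.continuous.comp_aestronglyMeasurable₂
        hLc.aestronglyMeasurable (intervalIntegrable_iff.1 hint).aestronglyMeasurable
    · refine (ae_restrict_iff' measurableSet_uIoc).2 ?_
      filter_upwards [hC] with s hs hsI
      rw [Real.norm_of_nonneg (by positivity)]
      exact ((L s).le_opNorm _).trans (mul_le_mul ((hB s (hIoc hsI)).trans (le_abs_self _))
        ((hs (hIoc hsI)).trans (le_abs_self _)) (norm_nonneg _) (abs_nonneg _))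
  have hkL := lipschitzOnWith_primitive hkint hkC
  obtain ⟨K', hLw⟩ := LipschitzOnWith.exists_clm_apply hLL hwL hB hW
  rw [← Set.uIcc_of_le hT] at hkL hLw
  -- Both sides are Lipschitz in the upper limit; their difference is absolutely continuous with
  -- derivative zero almost everywhere, hence constant.
  have hac := hLw.absolutelyContinuousOnInterval.sub hkL.absolutelyContinuousOnInterval
  obtain ⟨c, hc⟩ := hac.const_of_ae_hasDerivAt_zero (by
    filter_upwards [hint.ae_hasDerivAt_integral, hkint.ae_hasDerivAt_integral] with s h1 h2 hs
    have h3 := ((hL s).clm_apply ((h1 hs 0 Set.left_mem_uIcc).const_add x)).sub (h2 hs 0 Set.left_mem_uIcc)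
    rwa [sub_self] at h3)
  have h0 := hc 0 Set.left_mem_uIcc
  have h1 := hc T Set.right_mem_uIcc
  simp only [Pi.sub_apply, intervalIntegral.integral_same, sub_zero] at h0 h1
  rw [← h0, hw] at h1
  simp only [intervalIntegral.integral_same, add_zero] at h1
  exact (sub_eq_iff_eq_add.1 h1).symm

end ibp

/-! ### The linear flow and variation of constants. -/

section flow

variable {E : Type*} [NormedAddCommGroup E] [NormedSpace ℝ E] [CompleteSpace E]

/-- The flow `t ↦ exp (t 𝒜)` of a linear vector field. -/
noncomputable def flow (𝒜 : E →L[ℝ] E) (t : ℝ) : E →L[ℝ] E := NormedSpace.exp (t • 𝒜)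

variable (𝒜 : E →L[ℝ] E)

theorem hasDerivAt_flow (t : ℝ) : HasDerivAt (flow 𝒜) (𝒜 * flow 𝒜 t) t :=
  hasDerivAt_exp_smul_const' 𝒜 t

theorem hasDerivAt_flow' (t : ℝ) : HasDerivAt (flow 𝒜) (flow 𝒜 t * 𝒜) t :=
  hasDerivAt_exp_smul_const 𝒜 t

theorem continuous_flow : Continuous (flow 𝒜) :=
  continuous_iff_continuousAt.2 fun t => (hasDerivAt_flow 𝒜 t).continuousAt

theorem hasDerivAt_flow_neg (t : ℝ) :
    HasDerivAt (fun t => flow 𝒜 (-t)) (-(flow 𝒜 (-t) * 𝒜)) t := by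
  have := (hasDerivAt_flow' 𝒜 (-t)).scomp t (hasDerivAt_neg t)
  rwa [neg_one_smul] at this

omit [CompleteSpace E] in
theorem flow_zero : flow 𝒜 0 = 1 := by
  simp [flow, NormedSpace.exp_zero]

theorem flow_add (s t : ℝ) : flow 𝒜 (s + t) = flow 𝒜 s * flow 𝒜 t := by
  let : NormedAlgebra ℚ (E →L[ℝ] E) := NormedAlgebra.restrictScalars ℚ ℝ _
  rw [flow, flow, flow, add_smul, NormedSpace.exp_add_of_commute]
  exact ((Commute.refl 𝒜).smul_left s).smul_right t

theorem flow_neg_apply_flow (t : ℝ) (x : E) : flow 𝒜 (-t) (flow 𝒜 t x) = x := by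
  change (flow 𝒜 (-t) * flow 𝒜 t) x = x
  rw [← flow_add, neg_add_cancel, flow_zero]
  rfl

theorem flow_apply_flow_neg (t : ℝ) (x : E) : flow 𝒜 t (flow 𝒜 (-t) x) = x := by
  simpa using flow_neg_apply_flow 𝒜 (-t) x

theorem hasDerivAt_flow_pow_apply (b : E) (j : ℕ) (t : ℝ) :
    HasDerivAt (fun t => flow 𝒜 t ((𝒜 ^ j) b)) (flow 𝒜 t ((𝒜 ^ (j + 1)) b)) t := by
  have := (hasDerivAt_flow' 𝒜 t).clm_apply (hasDerivAt_const t ((𝒜 ^ j) b))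
  simpa [pow_succ'] using this

variable {𝒜}

/-- Variation of constants: every solution of the integral equation is given by the formula. -/
theorem flow_neg_apply_trajectory {x : E} {β y : ℝ → E} {C T : ℝ} (hT : 0 ≤ T)
    (hβ : IntervalIntegrable β volume 0 T) (hC : ∀ᵐ s, ‖β s‖ ≤ C)
    (hy : ContinuousOn y (Set.Icc 0 T))
    (hyt : ∀ t ∈ Set.Icc 0 T, y t = x + ∫ s in (0 : ℝ)..t, (𝒜 (y s) + β s)) :
    flow 𝒜 (-T) (y T) = x + ∫ s in (0 : ℝ)..T, flow 𝒜 (-s) (β s) := by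
  have hAy : ContinuousOn (fun s => 𝒜 (y s)) (Set.Icc 0 T) := 𝒜.continuous.comp_continuousOn hy
  obtain ⟨B, hB⟩ := isCompact_Icc.exists_bound_of_continuousOn hAy
  have hAyint : IntervalIntegrable (fun s => 𝒜 (y s)) volume 0 T :=
    ContinuousOn.intervalIntegrable (by rwa [Set.uIcc_of_le hT])
  have hneg : Continuous fun s => flow 𝒜 (-s) := (continuous_flow 𝒜).comp continuous_neg
  have hL' : Continuous fun s => -(flow 𝒜 (-s) * 𝒜) := (hneg.mul continuous_const).neg
  have key := integral_clm_apply_primitive (hasDerivAt_flow_neg 𝒜) hL' x hT (hAyint.add hβ)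
    (C := B + C) (by
      filter_upwards [hC] with s hs hsI
      exact (norm_add_le _ _).trans (add_le_add (hB s hsI) hs))
  rw [← hyt T ⟨hT, le_rfl⟩, neg_zero, flow_zero] at key
  rw [← key]
  congr 1
  refine intervalIntegral.integral_congr fun s hs => ?_
  rw [Set.uIcc_of_le hT] at hs
  rw [← hyt s hs, map_add]
  change -(flow 𝒜 (-s) (𝒜 (y s))) + _ = _
  abel

/-- Variation of constants: the formula gives a solution of the integral equation. -/
theorem flow_apply_primitive {x : E} {β : ℝ → E} {C T : ℝ} (hT : 0 ≤ T)
    (hβ : AEStronglyMeasurable β) (hC : ∀ᵐ s, ‖β s‖ ≤ C) :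
    flow 𝒜 T (x + ∫ s in (0 : ℝ)..T, flow 𝒜 (-s) (β s)) = x + ∫ s in (0 : ℝ)..T,
      (𝒜 (flow 𝒜 s (x + ∫ σ in (0 : ℝ)..s, flow 𝒜 (-σ) (β σ))) + β s) := by
  have hneg : Continuous fun s => flow 𝒜 (-s) := (continuous_flow 𝒜).comp continuous_neg
  obtain ⟨B, hB⟩ := (isCompact_Icc (a := (0 : ℝ)) (b := T)).exists_bound_of_continuousOn
    hneg.continuousOn
  have hbd : ∀ᵐ s, s ∈ Set.Icc 0 T → ‖flow 𝒜 (-s) (β s)‖ ≤ |B| * |C| := by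
    filter_upwards [hC] with s hs hsI
    exact ((flow 𝒜 (-s)).le_opNorm _).trans (mul_le_mul ((hB s hsI).trans (le_abs_self _))
      (hs.trans (le_abs_self _)) (norm_nonneg _) (abs_nonneg _))
  have hint : IntervalIntegrable (fun s => flow 𝒜 (-s) (β s)) volume 0 T := by
    refine (intervalIntegrable_const (c := |B| * |C|)).mono_fun ?_ ?_
    · exact isBoundedBilinearMap_apply.continuous.comp_aestronglyMeasurable₂
        hneg.aestronglyMeasurable hβ.restrict
    · refine (ae_restrict_iff' measurableSet_uIoc).2 ?_
      filter_upwards [hbd] with s hs hsI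
      rw [Real.norm_of_nonneg (by positivity)]
      exact hs (Set.uIcc_of_le hT ▸ Set.uIoc_subset_uIcc hsI)
  rw [← integral_clm_apply_primitive (hasDerivAt_flow 𝒜)
    (continuous_const.mul (continuous_flow 𝒜)) x hT hint hbd, flow_zero]
  congr 1
  refine intervalIntegral.integral_congr fun s _ => ?_
  simp only [flow_apply_flow_neg]
  rfl

end flow

/-! ### Extremal points and relative closedness. -/

section extremal

variable {E : Type*} [NormedAddCommGroup E] [InnerProductSpace ℝ E] [CompleteSpace E]
variable {ι : Type*}

/-- The columns `b i` together generate no proper `𝒜`-invariant subspace, each one on its own. -/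
def IsNormalPair (𝒜 : E →L[ℝ] E) (b : ι → E) : Prop :=
  ∀ i ζ, (∀ j : ℕ, inner ℝ ζ ((𝒜 ^ j) (b i)) = 0) → ζ = 0

/-- The extremal point `∑ i, ∫_0^r sign ⟪ζ, e^{t𝒜} b i⟫ e^{(t-r)𝒜} b i dt`. -/
noncomputable def extremalPoint [Fintype ι] (𝒜 : E →L[ℝ] E) (b : ι → E) (ζ : E) (r : ℝ) : E :=
  ∑ i, ∫ t in (0 : ℝ)..r, Real.sign (inner ℝ ζ (flow 𝒜 t (b i))) • flow 𝒜 (t - r) (b i)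

variable {𝒜 : E →L[ℝ] E} {b : ι → E}

theorem continuous_flow_apply (x : E) : Continuous fun t => flow 𝒜 t x :=
  (continuous_flow 𝒜).clm_apply continuous_const

theorem continuous_flow_neg_apply (x : E) : Continuous fun t => flow 𝒜 (-t) x :=
  (continuous_flow_apply x).comp continuous_neg

theorem inner_adjoint_flow (ζ x : E) (r t : ℝ) :
    inner ℝ ((flow 𝒜 r).adjoint ζ) (flow 𝒜 (-t) x) = inner ℝ ζ (flow 𝒜 (r - t) x) := by
  rw [ContinuousLinearMap.adjoint_inner_left, sub_eq_add_neg, flow_add]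
  rfl

theorem adjoint_flow_ne_zero {ζ : E} (hζ : ζ ≠ 0) (r : ℝ) : (flow 𝒜 r).adjoint ζ ≠ 0 := by
  intro h
  have := inner_adjoint_flow (𝒜 := 𝒜) ζ ζ r r
  rw [h, inner_zero_left, sub_self, flow_zero] at this
  exact hζ ((inner_self_eq_zero (𝕜 := ℝ)).1 this.symm)

theorem IsNormalPair.exists_inner_ne_zero (h : IsNormalPair 𝒜 b) {ζ : E} (hζ : ζ ≠ 0) (i : ι)
    (t : ℝ) : ∃ j : ℕ, inner ℝ ζ (flow 𝒜 t ((𝒜 ^ j) (b i))) ≠ 0 := by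
  by_contra! hc
  refine adjoint_flow_ne_zero (𝒜 := 𝒜) hζ t (h i _ fun j => ?_)
  rw [ContinuousLinearMap.adjoint_inner_left, hc j]

theorem IsNormalPair.countable_zeros (h : IsNormalPair 𝒜 b) {ζ : E} (hζ : ζ ≠ 0) (i : ι) :
    {t | inner ℝ ζ (flow 𝒜 t (b i)) = 0}.Countable :=
  _root_.countable_zeros (f := fun j t => inner ℝ ζ (flow 𝒜 t ((𝒜 ^ j) (b i))))
    (hasDerivAt_inner_left (fun j t => hasDerivAt_flow_pow_apply 𝒜 (b i) j t) ζ)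
    (h.exists_inner_ne_zero hζ i)

theorem IsNormalPair.countable_zeros_neg (h : IsNormalPair 𝒜 b) {ζ : E} (hζ : ζ ≠ 0) (i : ι) :
    {t | inner ℝ ζ (flow 𝒜 (-t) (b i)) = 0}.Countable :=
  (h.countable_zeros hζ i).preimage neg_injective

section fintype

variable [Fintype ι]

/-- Here the integrand is free of `r`; this form serves for continuity and Lipschitz estimates in
`(ζ, r)`. -/
theorem extremalPoint_eq_flow (ζ : E) (r : ℝ) : extremalPoint 𝒜 b ζ r =
    flow 𝒜 (-r) (signIntegral (fun i t => flow 𝒜 t (b i)) ζ r) := by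
  rw [extremalPoint, signIntegral, map_sum]
  refine Finset.sum_congr rfl fun i _ => ?_
  rw [← ContinuousLinearMap.intervalIntegral_comp_comm _
    (intervalIntegrable_sign_smul (continuous_flow_apply (b i)) _ _ _)]
  refine intervalIntegral.integral_congr fun t _ => ?_
  simp only [map_smul]
  rw [sub_eq_add_neg, add_comm, flow_add]
  rfl

/-- The substitution `t ↦ r - t` moves the flow onto the covector. This form relates extremal points
to reachable sets. -/
theorem extremalPoint_eq_signIntegral (ζ : E) (r : ℝ) : extremalPoint 𝒜 b ζ r =
    signIntegral (fun i t => flow 𝒜 (-t) (b i)) ((flow 𝒜 r).adjoint ζ) r := by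
  refine Finset.sum_congr rfl fun i _ => ?_
  have := intervalIntegral.integral_comp_sub_left (a := 0) (b := r)
    (fun t => Real.sign (inner ℝ ζ (flow 𝒜 t (b i))) • flow 𝒜 (t - r) (b i)) r
  simp only [sub_zero, sub_self] at this
  rw [← this]
  refine intervalIntegral.integral_congr fun t _ => ?_
  simp only [inner_adjoint_flow]
  congr 3
  ring

omit [CompleteSpace E] in
theorem extremalPoint_zero (ζ : E) : extremalPoint 𝒜 b ζ 0 = 0 := by
  simp [extremalPoint]

omit [CompleteSpace E] in
theorem extremalPoint_smul {a : ℝ} (ha : 0 < a) (ζ : E) (r : ℝ) :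
    extremalPoint 𝒜 b (a • ζ) r = extremalPoint 𝒜 b ζ r := by
  simp only [extremalPoint, real_inner_smul_left, Real.sign_mul_of_pos ha]

theorem extremalPoint_mem_reachSet (ζ : E) (r : ℝ) :
    extremalPoint 𝒜 b ζ r ∈ reachSet (fun i t => flow 𝒜 (-t) (b i)) r := by
  rw [extremalPoint_eq_signIntegral]
  exact signIntegral_mem_reachSet (fun i => continuous_flow_neg_apply (b i)) _ _

theorem extremalPoint_notMem_closure [Nonempty ι] (h : IsNormalPair 𝒜 b) {ζ : E} (hζ : ζ ≠ 0)
    {s r : ℝ} (hs : 0 ≤ s) (hsr : s < r) :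
    extremalPoint 𝒜 b ζ r ∉ closure (reachSet (fun i t => flow 𝒜 (-t) (b i)) s) := by
  rw [extremalPoint_eq_signIntegral]
  exact signIntegral_notMem_closure_reachSet (fun i => continuous_flow_neg_apply (b i))
    (h.countable_zeros_neg (adjoint_flow_ne_zero hζ r)) hs hsr

theorem extremalPoint_ne_zero [Nonempty ι] (h : IsNormalPair 𝒜 b) {ζ : E} (hζ : ζ ≠ 0)
    {r : ℝ} (hr : 0 < r) : extremalPoint 𝒜 b ζ r ≠ 0 := by
  rw [extremalPoint_eq_signIntegral]
  exact signIntegral_ne_zero (fun i => continuous_flow_neg_apply (b i))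
    (h.countable_zeros_neg (adjoint_flow_ne_zero hζ r)) hr

theorem IsNormalPair.reachSet_subset_interior [FiniteDimensional ℝ E] [Nonempty ι]
    (h : IsNormalPair 𝒜 b) {s r : ℝ} (hs : 0 ≤ s) (hsr : s < r) :
    reachSet (fun i t => flow 𝒜 (-t) (b i)) s ⊆
      interior (reachSet (fun i t => flow 𝒜 (-t) (b i)) r) :=
  _root_.reachSet_subset_interior (fun i => continuous_flow_neg_apply (b i))
    (fun _ hη => h.countable_zeros_neg hη) hs hsr

/-- An earlier point would be interior, a later one outside the closure. -/
theorem eq_of_extremalPoint_mem_frontier [FiniteDimensional ℝ E] [Nonempty ι]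
    (h : IsNormalPair 𝒜 b) {ζ : E} (hζ : ζ ≠ 0) {s r : ℝ} (hs : 0 ≤ s) (hr : 0 ≤ r)
    (hmem : extremalPoint 𝒜 b ζ r ∈ frontier (reachSet (fun i t => flow 𝒜 (-t) (b i)) s)) :
    r = s := by
  rcases lt_trichotomy r s with hlt | heq | hlt
  · exact absurd (h.reachSet_subset_interior hr hlt (extremalPoint_mem_reachSet ζ r)) hmem.2
  · exact heq
  · exact absurd hmem.1 (extremalPoint_notMem_closure h hζ hs hlt)

theorem continuousAt_extremalPoint (h : IsNormalPair 𝒜 b) {ζ : E} (hζ : ζ ≠ 0) (r : ℝ) :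
    ContinuousAt (fun p : E × ℝ => extremalPoint 𝒜 b p.1 p.2) (ζ, r) := by
  simp only [extremalPoint_eq_flow]
  have h1 : Continuous fun p : E × ℝ => flow 𝒜 (-p.2) :=
    (continuous_flow 𝒜).comp continuous_snd.neg
  exact h1.continuousAt.clm_apply (continuousAt_signIntegral
    (fun i => continuous_flow_apply (b i)) (h.countable_zeros hζ) r)

/-- The extremal points given by unit covectors orthogonal to all `b i`. -/
def extremalSet (𝒜 : E →L[ℝ] E) (b : ι → E) : Set E :=
  {x | ∃ r : ℝ, 0 < r ∧ ∃ ζ ∈ Metric.sphere (0 : E) 1,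
    x = extremalPoint 𝒜 b ζ r ∧ ∀ i, inner ℝ ζ (b i) = 0}

theorem extremalSet_eq_closure_inter [FiniteDimensional ℝ E] [Nonempty ι]
    (h : IsNormalPair 𝒜 b) :
    extremalSet 𝒜 b = closure (extremalSet 𝒜 b) ∩
      ({x | ∃ r, 0 ≤ r ∧ x ∈ reachSet (fun i t => flow 𝒜 (-t) (b i)) r} \ {0}) := by
  refine Set.Subset.antisymm (fun x hx => ⟨subset_closure hx, ?_⟩) ?_
  · obtain ⟨r, hr, ζ, hζ, rfl, -⟩ := hx
    exact ⟨⟨r, hr.le, extremalPoint_mem_reachSet ζ r⟩,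
      extremalPoint_ne_zero h (Metric.ne_of_mem_sphere hζ one_ne_zero) hr⟩
  · rintro x ⟨hx, ⟨ρ, hρ, hxρ⟩, hx0⟩
    let H : Set E := ⋂ i, {ζ | inner ℝ ζ (b i) = 0}
    have hH : IsClosed H := isClosed_iInter fun i =>
      isClosed_eq (continuous_id.inner continuous_const) continuous_const
    -- Near `x` only times up to `ρ + 1` occur. Time 0 is included for compactness; it yields only
    -- the origin, which is excluded.
    let K : Set (E × ℝ) := (Metric.sphere (0 : E) 1 ∩ H) ×ˢ Set.Icc 0 (ρ + 1)
    have hK : IsCompact K := ((isCompact_sphere 0 1).inter_right hH).prod isCompact_Icc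
    have hcont : ContinuousOn (fun p : E × ℝ => extremalPoint 𝒜 b p.1 p.2) K := fun p hp =>
      (continuousAt_extremalPoint h (Metric.ne_of_mem_sphere hp.1.1 one_ne_zero) p.2).continuousWithinAt
    have hcl := (hK.image_of_continuousOn hcont).isClosed
    have hxint := h.reachSet_subset_interior hρ (lt_add_one ρ) hxρ
    have hx' := isOpen_interior.inter_closure ⟨hxint, hx⟩
    have hsub : interior (reachSet (fun i t => flow 𝒜 (-t) (b i)) (ρ + 1)) ∩ extremalSet 𝒜 b ⊆
        (fun p : E × ℝ => extremalPoint 𝒜 b p.1 p.2) '' K := by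
      rintro _ ⟨hy, r, hr, ζ, hζ, rfl, hζb⟩
      refine ⟨(ζ, r), ⟨⟨hζ, Set.mem_iInter.2 hζb⟩, hr.le, ?_⟩, rfl⟩
      by_contra! hlt
      exact extremalPoint_notMem_closure h (Metric.ne_of_mem_sphere hζ one_ne_zero) (by linarith) hlt
        (subset_closure (interior_subset hy))
    obtain ⟨⟨ζ, r⟩, ⟨⟨hζ, hζb⟩, hr⟩, rfl⟩ := closure_minimal hsub hcl hx'
    refine ⟨r, lt_of_le_of_ne hr.1 ?_, ζ, hζ, rfl, fun i => Set.mem_iInter.1 (show ζ ∈ H from hζb) i⟩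
    rintro rfl
    exact hx0 (extremalPoint_zero ζ)

theorem exists_lipschitzOnWith_extremalPoint (R : ℕ) (S : ι → Finset ZeroDatum) :
    ∃ K, LipschitzOnWith K (fun p : E × ℝ => extremalPoint 𝒜 b p.1 p.2)
      (zeroPiece (fun i j t => flow 𝒜 t ((𝒜 ^ j) (b i))) R S) := by
  obtain ⟨⟨K, hK⟩, C, hC⟩ := exists_lipschitzOnWith_signIntegral
    (fun i j t => hasDerivAt_flow_pow_apply 𝒜 (b i) j t) R S
  have hneg : Continuous fun t => flow 𝒜 (-t) := (continuous_flow 𝒜).comp continuous_neg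
  obtain ⟨L, hL⟩ := exists_lipschitzOnWith_Icc (hasDerivAt_flow_neg 𝒜)
    (hneg.mul continuous_const).neg 0 R
  obtain ⟨B, hB⟩ := (isCompact_Icc (a := (0 : ℝ)) (b := R)).exists_bound_of_continuousOn
    hneg.continuousOn
  have hL' : LipschitzOnWith L (fun p : E × ℝ => flow 𝒜 (-p.2))
      (zeroPiece (fun i j t => flow 𝒜 t ((𝒜 ^ j) (b i))) R S) := by
    rw [← mul_one L]
    exact hL.comp LipschitzWith.prod_snd.lipschitzOnWith (fun p hp => hp.1)
  obtain ⟨K', hK'⟩ := hL'.exists_clm_apply hK (fun p hp => hB p.2 hp.1) hC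
  refine ⟨K', ?_⟩
  simp only [extremalPoint_eq_flow]
  exact hK'

end fintype

end extremal

/-! ### Countable Lipschitz covers and charts of rays. -/

theorem CoveredByLipschitzImages.of_countable {N d : ℕ} {V κ : Type*} [NormedAddCommGroup V]
    [NormedSpace ℝ V] [FiniteDimensional ℝ V] (hV : Module.finrank ℝ V = d) [Countable κ]
    {X : Set (EuclideanSpace ℝ (Fin N))} (f : κ → V → EuclideanSpace ℝ (Fin N)) (D : κ → Set V)
    (hf : ∀ k, ∃ K, LipschitzOnWith K (f k) (D k)) (hX : X ⊆ ⋃ k, f k '' D k) :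
    CoveredByLipschitzImages d X := by
  choose K hK using hf
  choose g hg hgf using fun k => (hK k).extend_finite_dimension
  let e : EuclideanSpace ℝ (Fin d) ≃L[ℝ] V :=
    ContinuousLinearEquiv.ofFinrankEq (by rw [finrank_euclideanSpace_fin, hV])
  -- `Option κ` is nonempty even if `κ` is empty, so it can be enumerated; `none` gets a constant
  -- map.
  obtain ⟨s, hs⟩ := exists_surjective_nat (Option κ)
  let F : Option κ → EuclideanSpace ℝ (Fin d) → EuclideanSpace ℝ (Fin N) :=
    fun o => o.elim (fun _ => 0) (fun k v => g k (e v))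
  have hF : ∀ o, ∃ K, LipschitzWith K (F o)
    | none => ⟨0, LipschitzWith.const (0 : EuclideanSpace ℝ (Fin N))⟩
    | some k => by
      have h := (hg k).comp e.lipschitz
      exact ⟨_, h⟩
  refine ⟨fun j => F (s j), fun j => hF (s j), fun x hx => ?_⟩
  obtain ⟨k, v, hv, rfl⟩ := Set.mem_iUnion.1 (hX hx)
  obtain ⟨j, hj⟩ := hs (some k)
  refine Set.mem_iUnion.2 ⟨j, e.symm v, ?_⟩
  simp only [hj, F, Option.elim_some, ContinuousLinearEquiv.apply_symm_apply]
  exact (hgf k hv).symm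

section charts

variable {E : Type*} [NormedAddCommGroup E] [NormedSpace ℝ E] {n : ℕ}

/-- The affine chart `c ↦ σ β j + ∑ k, c k β (j.succAbove k)` of the space of rays. -/
noncomputable def rayChart (β : Fin (n + 1) → E) (j : Fin (n + 1)) (σ : ℤ) (c : Fin n → ℝ) : E :=
  (σ : ℝ) • β j + ∑ k, c k • β (j.succAbove k)

theorem exists_lipschitzWith_rayChart (β : Fin (n + 1) → E) (j : Fin (n + 1)) (σ : ℤ) :
    ∃ K, LipschitzWith K (rayChart β j σ) := by
  let L : (Fin n → ℝ) →L[ℝ] E := ∑ k, (ContinuousLinearMap.proj k).smulRight (β (j.succAbove k))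
  refine ⟨0 + ‖L‖₊, ?_⟩
  have : rayChart β j σ = fun c => (σ : ℝ) • β j + L c := by
    funext c
    simp [rayChart, L]
  rw [this]
  exact (LipschitzWith.const _).add L.lipschitz

/-- Dividing by the modulus of a nonzero coordinate turns it into `σ = ±1`. The factor is positive,
so the ray is kept. -/
theorem exists_rayChart {β : Fin (n + 1) → E} {ζ : E} (hζ : ζ ≠ 0)
    (hspan : ∃ c : Fin (n + 1) → ℝ, ζ = ∑ k, c k • β k) :
    ∃ j σ c, ∃ a : ℝ, 0 < a ∧ rayChart β j σ c = a • ζ := by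
  obtain ⟨c, rfl⟩ := hspan
  obtain ⟨j, hj⟩ : ∃ j, c j ≠ 0 := by
    by_contra! h
    exact hζ (by simp [h])
  obtain ⟨σ, hσ⟩ : ∃ σ : ℤ, (σ : ℝ) = |c j|⁻¹ * c j := by
    rcases abs_cases (c j) with ⟨h, _⟩ | ⟨h, _⟩
    · exact ⟨1, by rw [h]; simp [hj]⟩
    · exact ⟨-1, by rw [h, inv_neg, neg_mul, inv_mul_cancel₀ hj]; simp⟩
  refine ⟨j, σ, fun k => |c j|⁻¹ * c (j.succAbove k), |c j|⁻¹, by positivity, ?_⟩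
  rw [Fin.sum_univ_succAbove _ j, rayChart, hσ, smul_add, Finset.smul_sum]
  simp only [mul_smul]

end charts

section cover

variable {N n : ℕ} {ι : Type*} [Fintype ι]
  {𝒜 : EuclideanSpace ℝ (Fin N) →L[ℝ] EuclideanSpace ℝ (Fin N)}
  {b : ι → EuclideanSpace ℝ (Fin N)}

theorem exists_rayChart_mem_zeroPiece (h : IsNormalPair 𝒜 b)
    {β : Fin (n + 1) → EuclideanSpace ℝ (Fin N)} {ζ : EuclideanSpace ℝ (Fin N)} (hζ : ζ ≠ 0)
    (hspan : ∃ c : Fin (n + 1) → ℝ, ζ = ∑ k, c k • β k) {r : ℝ} (hr : 0 ≤ r) :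
    ∃ j σ R S c, (rayChart β j σ c, r) ∈ zeroPiece (fun i j t => flow 𝒜 t ((𝒜 ^ j) (b i))) R S ∧
      extremalPoint 𝒜 b (rayChart β j σ c) r = extremalPoint 𝒜 b ζ r := by
  obtain ⟨j, σ, c, a, ha, hc⟩ := exists_rayChart hζ hspan
  have hne : rayChart β j σ c ≠ 0 := hc ▸ smul_ne_zero ha.ne' hζ
  obtain ⟨R, S, hRS⟩ := exists_mem_zeroPiece
    (fun i j t => hasDerivAt_flow_pow_apply 𝒜 (b i) j t) (h.exists_inner_ne_zero hne) hr
  exact ⟨j, σ, R, S, c, hRS, by rw [hc, extremalPoint_smul ha]⟩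

/-- The `n + 1` parameters are the time and the `n` affine coordinates of a ray; charts and zero
pieces are countable in number. -/
theorem coveredByLipschitzImages_extremalSet (h : IsNormalPair 𝒜 b)
    {β : Fin (n + 1) → EuclideanSpace ℝ (Fin N)}
    (hβ : ∀ ζ, (∀ i, inner ℝ ζ (b i) = 0) → ∃ c : Fin (n + 1) → ℝ, ζ = ∑ k, c k • β k) :
    CoveredByLipschitzImages (n + 1) (extremalSet 𝒜 b) := by
  refine CoveredByLipschitzImages.of_countable (V := ℝ × (Fin n → ℝ))
    (κ := Fin (n + 1) × ℤ × ℕ × (ι → Finset ZeroDatum)) (by simp [add_comm])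
    (fun k p => extremalPoint 𝒜 b (rayChart β k.1 k.2.1 p.2) p.1)
    (fun k => {p | (rayChart β k.1 k.2.1 p.2, p.1) ∈
      zeroPiece (fun i j t => flow 𝒜 t ((𝒜 ^ j) (b i))) k.2.2.1 k.2.2.2})
    (fun k => ?_) ?_
  · obtain ⟨K, hK⟩ := exists_lipschitzOnWith_extremalPoint (𝒜 := 𝒜) (b := b) k.2.2.1 k.2.2.2
    obtain ⟨L, hL⟩ := exists_lipschitzWith_rayChart β k.1 k.2.1
    have hc := (hL.comp (LipschitzWith.prod_snd (α := ℝ))).prodMk LipschitzWith.prod_fst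
    have h := hK.comp (hc.lipschitzOnWith (s := {p : ℝ × (Fin n → ℝ) | (rayChart β k.1 k.2.1 p.2, p.1) ∈
      zeroPiece (fun i j t => flow 𝒜 t ((𝒜 ^ j) (b i))) k.2.2.1 k.2.2.2})) fun p hp => hp
    exact ⟨_, h⟩
  · rintro _ ⟨r, hr, ζ, hζ, rfl, hζb⟩
    obtain ⟨j, σ, R, S, c, hmem, heq⟩ := exists_rayChart_mem_zeroPiece h
      (Metric.ne_of_mem_sphere hζ one_ne_zero) (hβ ζ hζb) hr.le
    exact Set.mem_iUnion.2 ⟨(j, σ, R, S), (r, c), hmem, heq⟩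

theorem coveredByLipschitzImages_extremalSet_inter_frontier [Nonempty ι] (h : IsNormalPair 𝒜 b)
    {β : Fin (n + 1) → EuclideanSpace ℝ (Fin N)}
    (hβ : ∀ ζ, (∀ i, inner ℝ ζ (b i) = 0) → ∃ c : Fin (n + 1) → ℝ, ζ = ∑ k, c k • β k)
    {r : ℝ} (hr : 0 ≤ r) :
    CoveredByLipschitzImages n
      (extremalSet 𝒜 b ∩ frontier (reachSet (fun i t => flow 𝒜 (-t) (b i)) r)) := by
  refine CoveredByLipschitzImages.of_countable (V := Fin n → ℝ)
    (κ := Fin (n + 1) × ℤ × ℕ × (ι → Finset ZeroDatum)) (by simp)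
    (fun k c => extremalPoint 𝒜 b (rayChart β k.1 k.2.1 c) r)
    (fun k => {c | (rayChart β k.1 k.2.1 c, r) ∈
      zeroPiece (fun i j t => flow 𝒜 t ((𝒜 ^ j) (b i))) k.2.2.1 k.2.2.2})
    (fun k => ?_) ?_
  · obtain ⟨K, hK⟩ := exists_lipschitzOnWith_extremalPoint (𝒜 := 𝒜) (b := b) k.2.2.1 k.2.2.2
    obtain ⟨L, hL⟩ := exists_lipschitzWith_rayChart β k.1 k.2.1
    have hc := hL.prodMk (LipschitzWith.const r)
    have h := hK.comp (hc.lipschitzOnWith (s := {c : Fin n → ℝ | (rayChart β k.1 k.2.1 c, r) ∈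
      zeroPiece (fun i j t => flow 𝒜 t ((𝒜 ^ j) (b i))) k.2.2.1 k.2.2.2})) fun p hp => hp
    exact ⟨_, h⟩
  · rintro _ ⟨⟨s, hs, ζ, hζ, rfl, hζb⟩, hfr⟩
    have hζ0 := Metric.ne_of_mem_sphere hζ one_ne_zero
    obtain rfl := eq_of_extremalPoint_mem_frontier h hζ0 hr hs.le hfr
    obtain ⟨j, σ, R, S, c, hmem, heq⟩ := exists_rayChart_mem_zeroPiece h hζ0 (hβ ζ hζb) hr
    exact Set.mem_iUnion.2 ⟨(j, σ, R, S), c, hmem, heq⟩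

end cover

/-! ### From the matrix control system to the abstract setting. -/

section euclidean

open scoped Matrix

variable {N M : ℕ} {A : Matrix (Fin N) (Fin N) ℝ} {B : Matrix (Fin N) (Fin M) ℝ}

theorem matAct_eq_toEuclideanCLM (A : Matrix (Fin N) (Fin N) ℝ) (v : EuclideanSpace ℝ (Fin N)) :
    matAct A v = Matrix.toEuclideanCLM (𝕜 := ℝ) A v := rfl

theorem expCol_eq_flow (i : Fin M) (t : ℝ) :
    expCol A B i t = flow (Matrix.toEuclideanCLM (𝕜 := ℝ) A) t (colVec B i) := by
  -- The exponential depends only on the topology; a norm is chosen to transport it along `φ`.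
  let : NormedRing (Matrix (Fin N) (Fin N) ℝ) := Matrix.linftyOpNormedRing
  let : NormedAlgebra ℝ (Matrix (Fin N) (Fin N) ℝ) := Matrix.linftyOpNormedAlgebra
  let : NormedAlgebra ℚ (Matrix (Fin N) (Fin N) ℝ) := NormedAlgebra.restrictScalars ℚ ℝ _
  let φ := Matrix.toEuclideanCLM (n := Fin N) (𝕜 := ℝ)
  have hφ : Continuous φ :=
    (φ.toAlgEquiv.toLinearEquiv.toLinearMap).continuous_of_finiteDimensional
  have h : φ (NormedSpace.exp (t • A)) = NormedSpace.exp (φ (t • A)) :=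
    NormedSpace.map_exp φ hφ (t • A)
  rw [map_smul] at h
  rw [expCol, matAct_eq_toEuclideanCLM, flow, ← h]

theorem toEuclideanCLM_pow_apply (j : ℕ) (v : EuclideanSpace ℝ (Fin N)) :
    (Matrix.toEuclideanCLM (𝕜 := ℝ) A ^ j) v = matAct (A ^ j) v := by
  rw [matAct_eq_toEuclideanCLM, map_pow]

theorem matAct_eq_sum (v : EuclideanSpace ℝ (Fin M)) :
    matAct B v = ∑ i, v i • colVec B i := by
  ext a
  simp [matAct, colVec, Matrix.mulVec, dotProduct, mul_comm]

theorem inner_eq_dotProduct_ofLp (x y : EuclideanSpace ℝ (Fin N)) :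
    inner ℝ x y = x.ofLp ⬝ᵥ y.ofLp := by
  rw [EuclideanSpace.inner_eq_star_dotProduct, dotProduct_comm]
  simp

/-- A square matrix of full rank has injective transpose, and a covector orthogonal to all `A ^ j
b_i` with `j < N` lies in the kernel of the transpose. -/
theorem IsNormalSystem.isNormalPair (h : IsNormalSystem A B) :
    IsNormalPair (Matrix.toEuclideanCLM (𝕜 := ℝ) A) (colVec B) := by
  intro i ζ hζ
  set P := Matrix.of (fun (a j : Fin N) => matAct (A ^ (j : ℕ)) (colVec B i) a) with hP
  have hrank : Pᵀ.rank = N := by rw [Matrix.rank_transpose]; exact h i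
  have hsurj : LinearMap.range Pᵀ.mulVecLin = ⊤ := by
    refine Submodule.eq_top_of_finrank_eq ?_
    rw [← Matrix.rank, hrank, Module.finrank_fin_fun]
  have hinj : Function.Injective Pᵀ.mulVecLin :=
    LinearMap.injective_iff_surjective.2 (LinearMap.range_eq_top.1 hsurj)
  have h0 : Pᵀ.mulVecLin ζ.ofLp = 0 := by
    funext j
    have := hζ j
    rw [toEuclideanCLM_pow_apply, inner_eq_dotProduct_ofLp, dotProduct_comm] at this
    exact this
  have := hinj (h0.trans (map_zero _).symm)
  ext a
  exact congrFun this a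

theorem singularSet_eq_extremalSet :
    singularSet A B = extremalSet (Matrix.toEuclideanCLM (𝕜 := ℝ) A) (colVec B) := by
  simp only [singularSet, extremalSet, extremalPoint, expCol_eq_flow]

/-- The vectors form a basis of the kernel of `Bᵀ`. Writing its positive dimension as a successor
fits the ray charts. -/
theorem exists_spanning_family (hk : B.rank < N) :
    ∃ β : Fin (N - B.rank - 1 + 1) → EuclideanSpace ℝ (Fin N),
      ∀ ζ, (∀ i, inner ℝ ζ (colVec B i) = 0) → ∃ c : Fin (N - B.rank - 1 + 1) → ℝ,
        ζ = ∑ k, c k • β k := by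
  have hfin : Module.finrank ℝ (LinearMap.ker Bᵀ.mulVecLin) = N - B.rank - 1 + 1 := by
    have h := Bᵀ.mulVecLin.finrank_range_add_finrank_ker
    rw [← Matrix.rank, Matrix.rank_transpose, Module.finrank_fin_fun] at h
    omega
  let e := Module.finBasisOfFinrankEq ℝ _ hfin
  refine ⟨fun k => WithLp.toLp 2 (e k : Fin N → ℝ), fun ζ hζ => ?_⟩
  have hmem : ζ.ofLp ∈ LinearMap.ker Bᵀ.mulVecLin := by
    rw [LinearMap.mem_ker]
    funext i
    have := hζ i
    rw [inner_eq_dotProduct_ofLp, dotProduct_comm] at this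
    exact this
  refine ⟨e.repr ⟨ζ.ofLp, hmem⟩, ?_⟩
  have h := congrArg (fun x : LinearMap.ker Bᵀ.mulVecLin => (x : Fin N → ℝ))
    (e.sum_repr ⟨ζ.ofLp, hmem⟩)
  ext a
  have ha := congrFun h a
  simp only [Submodule.coe_sum, Submodule.coe_smul, Finset.sum_apply, Pi.smul_apply] at ha
  simp [← ha]

theorem aestronglyMeasurable_sum_control_and_bounded {u : Fin M → ℝ → ℝ} (hu : ∀ i, Measurable (u i))
    (hu1 : ∀ i, ∀ᵐ s, |u i s| ≤ 1) (b : Fin M → EuclideanSpace ℝ (Fin N)) :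
    AEStronglyMeasurable (fun s => ∑ i, u i s • b i) volume ∧
      ∃ C : ℝ, ∀ᵐ s, ‖∑ i, u i s • b i‖ ≤ C := by
  constructor
  · exact Finset.aestronglyMeasurable_fun_sum _ fun i _ =>
      (hu i).aestronglyMeasurable.smul aestronglyMeasurable_const
  · refine ⟨∑ i, ‖b i‖, ?_⟩
    filter_upwards [ae_all_iff.2 hu1] with s hs
    refine norm_sum_le_of_le _ fun i _ => ?_
    rw [norm_smul, Real.norm_eq_abs]
    exact mul_le_of_le_one_left (norm_nonneg _) (hs i)

theorem intervalIntegrable_sum_control_smul {u : Fin M → ℝ → ℝ} (hu : ∀ i, Measurable (u i))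
    (hu1 : ∀ i, ∀ᵐ s, |u i s| ≤ 1) {w : Fin M → ℝ → EuclideanSpace ℝ (Fin N)}
    (hw : ∀ i, Continuous (w i)) (a b : ℝ) :
    IntervalIntegrable (fun s => ∑ i, u i s • w i s) volume a b := by
  have h := IntervalIntegrable.sum (μ := volume) (a := a) (b := b) Finset.univ
    (f := fun i s => u i s • w i s)
    fun i _ => intervalIntegrable_control_smul (hw i) (hu i) (hu1 i) a b
  rwa [Finset.sum_fn] at h

theorem integral_flow_sum_control (𝒜 : EuclideanSpace ℝ (Fin N) →L[ℝ] EuclideanSpace ℝ (Fin N))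
    {u : Fin M → ℝ → ℝ} (hu : ∀ i, Measurable (u i)) (hu1 : ∀ i, ∀ᵐ s, |u i s| ≤ 1)
    (b : Fin M → EuclideanSpace ℝ (Fin N)) (t : ℝ) :
    ∫ s in (0 : ℝ)..t, flow 𝒜 (-s) (∑ i, u i s • b i) =
      ∑ i, ∫ s in (0 : ℝ)..t, u i s • flow 𝒜 (-s) (b i) := by
  rw [← intervalIntegral.integral_finsetSum fun i _ =>
    intervalIntegrable_control_smul (continuous_flow_neg_apply (b i)) (hu i) (hu1 i) _ _]
  simp only [map_sum, map_smul]

/-- By variation of constants, `y t = 0` means that `x` is minus the integral of `e^{-sA} B u`; the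
sign is absorbed by the symmetric control set. -/
theorem steerableWithin_eq_reachSet {r : ℝ} (hr : 0 ≤ r) : steerableWithin A B r =
    reachSet (fun i t => flow (Matrix.toEuclideanCLM (𝕜 := ℝ) A) (-t) (colVec B i)) r := by
  set 𝒜 := Matrix.toEuclideanCLM (𝕜 := ℝ) A with h𝒜
  refine Set.Subset.antisymm ?_ ?_
  · rintro x ⟨u, y, ⟨hu, hu1⟩, ⟨hy, hyt⟩, t, ht, hyt0⟩
    -- The origin may be reached at some `t ≤ r`; the control is then continued by zero.
    refine reachSet_mono (fun i => continuous_flow_neg_apply (colVec B i)) ht.1 ht.2 ?_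
    have hum : ∀ i, Measurable fun s => u s i := fun i => by fun_prop
    have hu1' : ∀ i, ∀ᵐ s, |u s i| ≤ 1 := fun i => by
      filter_upwards [hu1] with s hs
      exact abs_le.2 (hs i)
    obtain ⟨hβ, C, hC⟩ := aestronglyMeasurable_sum_control_and_bounded hum hu1' (colVec B)
    have hβint : IntervalIntegrable (fun s => ∑ i, u s i • colVec B i) volume 0 t :=
      intervalIntegrable_sum_control_smul hum hu1' (fun _ => continuous_const) _ _
    have key := flow_neg_apply_trajectory (𝒜 := 𝒜) ht.1 hβint hC
      (hy.mono Set.Icc_subset_Ici_self) (x := x) (fun s hs => by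
        rw [hyt s hs.1]
        simp only [matAct_eq_sum (B := B), matAct_eq_toEuclideanCLM, ← h𝒜])
    rw [hyt0, map_zero, integral_flow_sum_control 𝒜 hum hu1'] at key
    refine ⟨fun i s => -u s i, fun i => (hum i).neg, fun i => by simpa using hu1' i, ?_⟩
    simp only [neg_smul, intervalIntegral.integral_neg, Finset.sum_neg_distrib]
    exact eq_neg_of_add_eq_zero_left key.symm
  · rintro x ⟨v, hv, hv1, hx⟩
    have hv' : ∀ i, Measurable fun s => -v i s := fun i => (hv i).neg
    have hv1' : ∀ i, ∀ᵐ s, |-v i s| ≤ 1 := fun i => by simpa using hv1 i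
    obtain ⟨hβ, C, hC⟩ := aestronglyMeasurable_sum_control_and_bounded hv' hv1' (colVec B)
    let y : ℝ → EuclideanSpace ℝ (Fin N) := fun t =>
      flow 𝒜 t (x + ∫ s in (0 : ℝ)..t, flow 𝒜 (-s) (∑ i, (-v i s) • colVec B i))
    have hcont : Continuous y := by
      refine (continuous_flow 𝒜).clm_apply (continuous_const.add ?_)
      refine intervalIntegral.continuous_primitive (fun a b => ?_) 0
      simp only [map_sum, map_smul]
      exact intervalIntegrable_sum_control_smul hv' hv1'
        (fun i => continuous_flow_neg_apply (colVec B i)) _ _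
    refine ⟨fun s => WithLp.toLp 2 fun i => -v i s, y, ⟨?_, ?_⟩, ⟨hcont.continuousOn, ?_⟩,
      r, ⟨hr, le_rfl⟩, ?_⟩
    · exact (WithLp.measurable_toLp 2 _).comp (measurable_pi_lambda _ hv')
    · filter_upwards [ae_all_iff.2 hv1'] with s hs i
      exact abs_le.1 (hs i)
    · intro t ht
      simp only [matAct_eq_sum (B := B), matAct_eq_toEuclideanCLM, ← h𝒜]
      exact flow_apply_primitive ht hβ hC
    · simp only [y]
      rw [integral_flow_sum_control 𝒜 hv' hv1', hx]
      simp only [neg_smul, intervalIntegral.integral_neg, Finset.sum_neg_distrib, add_neg_cancel,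
        map_zero]

theorem steerable_eq : steerable A B = {x | ∃ r, 0 ≤ r ∧ x ∈
    reachSet (fun i t => flow (Matrix.toEuclideanCLM (𝕜 := ℝ) A) (-t) (colVec B i)) r} := by
  ext x
  rw [steerable, Set.mem_iUnion]
  constructor
  · rintro ⟨r, hx⟩
    have hr : 0 ≤ r := by
      obtain ⟨_, _, _, _, t, ht, _⟩ := hx
      exact ht.1.trans ht.2
    exact ⟨r, hr, steerableWithin_eq_reachSet hr ▸ hx⟩
  · rintro ⟨r, hr, hx⟩
    exact ⟨r, (steerableWithin_eq_reachSet hr).symm ▸ hx⟩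

theorem isOpen_steerable [Nonempty (Fin M)] (h : IsNormalSystem A B) : IsOpen (steerable A B) := by
  rw [isOpen_iff_mem_nhds, steerable_eq]
  rintro x ⟨r, hr, hx⟩
  refine Filter.mem_of_superset (mem_interior_iff_mem_nhds.1
    (h.isNormalPair.reachSet_subset_interior hr (lt_add_one r) hx)) fun y hy => ?_
  exact ⟨r + 1, by linarith, hy⟩

end euclidean

/-! ### The main theorem. -/

theorem theorem4p4 {N M : ℕ} (hN : 2 ≤ N) (hM : 1 ≤ M) (hMN : M ≤ N)
    (A : Matrix (Fin N) (Fin N) ℝ) (B : Matrix (Fin N) (Fin M) ℝ)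
    (hnormal : IsNormalSystem A B) (hk : B.rank < N) :
    (∃ C : Set (EuclideanSpace ℝ (Fin N)), IsClosed C ∧
      singularSet A B = C ∩ (steerable A B \ {0})) ∧
    IsCountablyRectifiable (N - B.rank) (singularSet A B) ∧
    ∀ r : ℝ, 0 < r →
      CoveredByLipschitzImages (N - B.rank - 1)
        (singularSet A B ∩ frontier (steerableWithin A B r)) := by
  have : Nonempty (Fin M) := ⟨⟨0, hM⟩⟩
  have hn := hnormal.isNormalPair
  obtain ⟨β, hβ⟩ := exists_spanning_family hk
  have hclosed : singularSet A B = closure (singularSet A B) ∩ (steerable A B \ {0}) := by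
    rw [singularSet_eq_extremalSet, steerable_eq]
    exact extremalSet_eq_closure_inter hn
  refine ⟨⟨_, isClosed_closure, hclosed⟩, ⟨?_, ?_⟩, fun r hr => ?_⟩
  -- By relative closedness and openness of the steerable set, S is Borel.
  · refine le_toOuterMeasure_caratheodory _ _ ?_
    rw [hclosed]
    exact isClosed_closure.measurableSet.inter
      ((isOpen_steerable hnormal).measurableSet.diff (measurableSet_singleton 0))
  · have h := coveredByLipschitzImages_extremalSet hn hβ
    rwa [Nat.sub_add_cancel (by omega), ← singularSet_eq_extremalSet] at h
  · rw [singularSet_eq_extremalSet, steerableWithin_eq_reachSet hr.le]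
    exact coveredByLipschitzImages_extremalSet_inter_frontier hn hβ hr.le
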